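/- Let $X$ and $Y$ be complex Hilbert spaces and let $A$, with domain $D(A)\subseteq X$, be the infinitesimal generator of a strongly continuous, exponentially stable semigroup $(T(t))_{t\ge 0}$ on $X$ (that is, $\|T(t)\|\le Me^{-\omega t}$ for all $t\ge0$, with some constants $M$ and $\omega>0$). Let $\mathcal H_\infty^-$ be the algebra of bounded analytic functions on $\mathbb C^-=\{s\in\mathbb C:\operatorname{Re}s<0\}$, with $\|g\|_\infty=\sup_{s\in\mathbb C^-}|g(s)|$. Each $g\in\mathcal H_\infty^-$ has a boundary function $g(i\omega)=\lim_{r\uparrow0}g(r+i\omega)$, defined for almost all $\omega\in\mathbb R$. Let $\mathcal H_2(X)$ be the space of Laplace transforms of functions in $L^2((0,\infty);X)$, identified with the closed subspace of $L^2(i\mathbb R;X)$ formed by their boundary functions; let $\Pi$ be the orthogonal projection of $L^2(i\mathbb R;X)$ onto $\mathcal H_2(X)$, let $\mathcal L$ be the Laplace transform, and put $$M_gf=\mathcal L^{-1}\bigl(\Pi(g\cdot\mathcal Lf)\bigr),\qquad f\in L^2((0,\infty);X).$$ The operator $g(A):D(A)\to X$ is the unique linear map, bounded for the graph norm on $D(A)$,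 such that for every $x_0\in D(A)$ $$M_g\bigl(T(\cdot)x_0\bigr)(t)=g(A)T(t)x_0\qquad\text{for almost all }t>0.$$ Let $C:D(A)\to Y$ be linear, and suppose there are constants $m_2$ and $m_1>0$ such that * (admissibility) for every $x_0\in D(A)$, $CT(\cdot)x_0\in L^2((0,\infty);Y)$ and $\int_0^\infty\|CT(t)x_0\|^2\,dt\le m_2\|x_0\|^2$; * (exact observability) for every $x_0\in X$, $\int_0^\infty\|CT(t)x_0\|^2\,dt\ge m_1\|x_0\|^2$, where for $x_0\notin D(A)$ the function $CT(\cdot)x_0$ is given by the bounded linear extension to $X$ of the map $x_0\mapsto CT(\cdot)x_0$ from $D(A)$ to $L^2((0,\infty);Y)$. Then the operators $g(A)$, $g\in\mathcal H_\infty^-$, are well defined (existence and uniqueness), every $g(A)$ extends to a bounded operator on $X$, and this extension satisfies $$\|g(A)\|\le\sqrt{\frac{m_2}{m_1}}\;\|g\|_\infty .$$ Thus $A$ has a bounded $\mathcal H_\infty^-$-calculus: the map sending $g$ to the bounded extension of $g(A)$ is a unital algebra homomorphism from $\mathcal H_\infty^-$ into the bounded operators on $X$, and for $\operatorname{Re}a>0$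 it sends $g(s)=(a-s)^{-1}$ to $(aI-A)^{-1}$. -/

import Mathlib

open MeasureTheory Filter Topology Set
open scoped NNReal ENNReal

noncomputable section

/-! ### Strongly continuous semigroups and their generators -/

/-- A strongly continuous semigroup `(T(t))_{t ≥ 0}` of bounded operators on `X`. -/
structure C0Semigroup (X : Type*) [NormedAddCommGroup X] [NormedSpace ℂ X] where
  toFun : ℝ≥0 → X →L[ℂ] X
  map_zero : toFun 0 = ContinuousLinearMap.id ℂ X
  map_add : ∀ s t : ℝ≥0, toFun (s + t) = (toFun s).comp (toFun t)
  tendsto_zero : ∀ x : X, Tendsto (fun t : ℝ≥0 => toFun t x) (𝓝[>] 0) (𝓝 x)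

namespace C0Semigroup

section Generator

variable {X : Type*} [NormedAddCommGroup X] [NormedSpace ℂ X]

/-- Exponential stability: `‖T(t)‖ ≤ M e^{-ωt}` for some `M` and some `ω > 0`. -/
def ExponentiallyStable (T : C0Semigroup X) : Prop :=
  ∃ M ω : ℝ, 0 < ω ∧ ∀ t : ℝ≥0, ‖T.toFun t‖ ≤ M * Real.exp (-(ω * t))

/-- The difference quotient `(T(h)x - x)/h`. -/
def diffQuot (T : C0Semigroup X) (x : X) (h : ℝ≥0) : X :=
  ((h : ℝ) : ℂ)⁻¹ • (T.toFun h x - x)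

/-- `y` is the right derivative at `0` of the orbit of `x`. -/
def HasGen (T : C0Semigroup X) (x y : X) : Prop :=
  Tendsto (T.diffQuot x) (𝓝[>] 0) (𝓝 y)

theorem HasGen.add {T : C0Semigroup X} {x y x' y' : X} (h : T.HasGen x y) (h' : T.HasGen x' y') :
    T.HasGen (x + x') (y + y') := by
  refine (Tendsto.add h h').congr fun t => ?_
  simp only [diffQuot, _root_.map_add, ← smul_add]
  congr 1
  abel

theorem HasGen.smul {T : C0Semigroup X} {x y : X} (c : ℂ) (h : T.HasGen x y) :
    T.HasGen (c • x) (c • y) := by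
  refine (Tendsto.const_smul h c).congr fun t => ?_
  simp only [diffQuot, map_smul, ← smul_sub]
  rw [smul_comm]

theorem HasGen.unique {T : C0Semigroup X} {x y y' : X} (h : T.HasGen x y) (h' : T.HasGen x y') :
    y = y' :=
  tendsto_nhds_unique h h'

/-- The infinitesimal generator `A` of the semigroup: its domain `D(A)` consists of the `x` for
which `lim_{h ↓ 0} (T(h)x - x)/h` exists, and `A x` is that limit. -/
def generator (T : C0Semigroup X) : X →ₗ.[ℂ] X where
  domain :=
    { carrier := {x | ∃ y, T.HasGen x y}
      zero_mem' := ⟨0, (tendsto_const_nhds (x := (0 : X))).congr fun t => by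
        simp [diffQuot]⟩
      add_mem' := by
        rintro a b ⟨y, hy⟩ ⟨z, hz⟩
        exact ⟨y + z, hy.add hz⟩
      smul_mem' := by
        rintro c a ⟨y, hy⟩
        exact ⟨c • y, hy.smul c⟩ }
  toFun :=
    { toFun := fun x => Classical.choose x.2
      map_add' := fun x x' => (Classical.choose_spec (x + x').2).unique
        ((Classical.choose_spec x.2).add (Classical.choose_spec x'.2))
      map_smul' := fun c x => (Classical.choose_spec (c • x).2).unique
        ((Classical.choose_spec x.2).smul c) }

theorem mem_domain {T : C0Semigroup X} {x : X} (t : ℝ≥0) (hx : x ∈ T.generator.domain) :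
    T.toFun t x ∈ T.generator.domain := by
  obtain ⟨y, hy⟩ := hx
  refine ⟨T.toFun t y, (((T.toFun t).continuous.tendsto y).comp hy).congr fun h => ?_⟩
  have h1 : T.toFun t (T.toFun h x) = T.toFun h (T.toFun t x) := by
    rw [← ContinuousLinearMap.comp_apply, ← ContinuousLinearMap.comp_apply, ← T.map_add,
      ← T.map_add, add_comm]
  simp only [Function.comp_apply, diffQuot, map_smul, map_sub, h1]

/-- `T(t) x` as an element of `D(A)`, for `x ∈ D(A)`. -/
def onDomain (T : C0Semigroup X) (t : ℝ≥0) (x : T.generator.domain) : T.generator.domain :=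
  ⟨T.toFun t x, mem_domain t x.2⟩

end Generator

end C0Semigroup

/-! ### Lebesgue spaces of vector-valued functions -/

/-- Lebesgue measure on the half-line `(0, ∞)`. -/
abbrev halfLine : Measure ℝ := (volume : Measure ℝ).restrict (Ioi 0)

/-- `L²((0, ∞); X)`. -/
abbrev L2Half (X : Type*) [NormedAddCommGroup X] := Lp X 2 halfLine

/-- `L²(ℝ; X)`. -/
abbrev L2Line (X : Type*) [NormedAddCommGroup X] := Lp X 2 (volume : Measure ℝ)

open Classical in
/-- The class in `L²(μ; X)` of a square-integrable function `u` (and `0` for other `u`). -/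
def toL2 {X : Type*} [NormedAddCommGroup X] (μ : Measure ℝ) (u : ℝ → X) : Lp X 2 μ :=
  if h : MemLp u 2 μ then h.toLp u else 0

namespace C0Semigroup

section Admissible

variable {X Y : Type*} [NormedAddCommGroup X] [NormedSpace ℂ X]
  [NormedAddCommGroup Y] [NormedSpace ℂ Y]

/-- The function `t ↦ C T(t) x₀` for `x₀ ∈ D(A)` (only `t > 0` matters). -/
def output (T : C0Semigroup X) (C : T.generator.domain →ₗ[ℂ] Y) (x₀ : T.generator.domain) :
    ℝ → Y :=
  fun t => C (T.onDomain t.toNNReal x₀)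

/-- `C : D(A) → Y` is an (infinite-time) admissible output operator, with admissibility
constant `m`. -/
def AdmissibleWith (T : C0Semigroup X) (C : T.generator.domain →ₗ[ℂ] Y) (m : ℝ) : Prop :=
  ∀ x₀ : T.generator.domain, MemLp (T.output C x₀) 2 halfLine ∧
    ∫ t in Ioi (0 : ℝ), ‖T.output C x₀ t‖ ^ 2 ≤ m * ‖(x₀ : X)‖ ^ 2

/-- `𝒪 : X → L²((0, ∞); Y)` is the bounded linear extension to `X` of `x₀ ↦ C T(·) x₀`,
`x₀ ∈ D(A)`. It exists if `C` is admissible, and it is unique because `D(A)` is dense. -/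
def IsOutputMap (T : C0Semigroup X) (C : T.generator.domain →ₗ[ℂ] Y) (O : X →L[ℂ] L2Half Y) :
    Prop :=
  ∀ x₀ : T.generator.domain, O (x₀ : X) =ᵐ[halfLine] T.output C x₀

/-- `(C, A)` is exactly observable with constant `m`: `∫₀^∞ ‖C T(t) x₀‖² dt ≥ m ‖x₀‖²` for all
`x₀ ∈ X`, where `C T(·) x₀` is given by the extended output map if `x₀ ∉ D(A)`. -/
def ExactlyObservableWith (T : C0Semigroup X) (C : T.generator.domain →ₗ[ℂ] Y) (m : ℝ) : Prop :=
  ∃ O : X →L[ℂ] L2Half Y, T.IsOutputMap C O ∧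
    ∀ x₀ : X, m * ‖x₀‖ ^ 2 ≤ ∫ t in Ioi (0 : ℝ), ‖O x₀ t‖ ^ 2

end Admissible

end C0Semigroup

/-! ### The algebra `H∞⁻` -/

/-- The algebra `H∞⁻` of functions that are analytic and bounded on the open left half-plane.
Its elements are functions on `ℂ` whose values outside the left half-plane are irrelevant. -/
def HInftyMinus : Subalgebra ℂ (ℂ → ℂ) where
  carrier := {g | DifferentiableOn ℂ g {s | s.re < 0} ∧ ∃ M : ℝ, ∀ s : ℂ, s.re < 0 → ‖g s‖ ≤ M}
  mul_mem' := by
    rintro f g ⟨hf, M, hM⟩ ⟨hg, N, hN⟩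
    refine ⟨hf.mul hg, M * N, fun s hs => ?_⟩
    rw [Pi.mul_apply, norm_mul]
    exact mul_le_mul (hM s hs) (hN s hs) (norm_nonneg _) ((norm_nonneg _).trans (hM s hs))
  add_mem' := by
    rintro f g ⟨hf, M, hM⟩ ⟨hg, N, hN⟩
    exact ⟨hf.add hg, M + N, fun s hs => (norm_add_le _ _).trans (add_le_add (hM s hs) (hN s hs))⟩
  algebraMap_mem' := fun c => ⟨differentiableOn_const c, ‖c‖, fun _ _ => le_rfl⟩

/-- `‖g‖_∞`, the supremum of `|g|` over the open left half-plane. -/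
def hInftyNorm (g : HInftyMinus) : ℝ := ⨆ s : {s : ℂ // s.re < 0}, ‖(g : ℂ → ℂ) s‖

/-- The boundary function `ω ↦ g(iω) = lim_{r ↑ 0} g(r + iω)` of `g`; by Fatou's theorem the limit
exists for almost all `ω`. -/
def boundaryFun (g : ℂ → ℂ) (ω : ℝ) : ℂ :=
  limUnder (𝓝[<] (0 : ℝ)) fun r : ℝ => g (r + ω * Complex.I)

/-! ### The Toeplitz operator `M_g` -/

/-- Extension by zero as a linear isometry `L²((0, ∞); X) → L²(ℝ; X)`. -/
def extendZero (X : Type*) [NormedAddCommGroup X] [NormedSpace ℂ X] :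
    L2Half X →ₗᵢ[ℂ] L2Line X where
  toFun f := ((memLp_indicator_iff_restrict measurableSet_Ioi).2 (Lp.memLp f)).toLp
    ((Ioi (0 : ℝ)).indicator f)
  map_add' f g := by
    rw [← MemLp.toLp_add]
    refine MemLp.toLp_congr _ _ ?_
    rw [← indicator_add']
    exact (ae_eq_restrict_iff_indicator_ae_eq measurableSet_Ioi).1 (Lp.coeFn_add f g)
  map_smul' c f := by
    rw [RingHom.id_apply, ← MemLp.toLp_const_smul]
    refine MemLp.toLp_congr _ _ ?_
    rw [show c • (Ioi (0 : ℝ)).indicator (f : ℝ → X) = (Ioi (0 : ℝ)).indicator (c • (f : ℝ → X))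
      from (indicator_const_smul _ c _).symm]
    exact (ae_eq_restrict_iff_indicator_ae_eq measurableSet_Ioi).1 (Lp.coeFn_smul c f)
  norm_map' f := by
    change ‖MemLp.toLp ((Ioi (0 : ℝ)).indicator (f : ℝ → X))
      ((memLp_indicator_iff_restrict measurableSet_Ioi).2 (Lp.memLp f))‖ = _
    rw [Lp.norm_toLp, eLpNorm_indicator_eq_eLpNorm_restrict measurableSet_Ioi, Lp.norm_def]

section Toeplitz

variable (X : Type*) [NormedAddCommGroup X] [InnerProductSpace ℂ X] [CompleteSpace X]

/-- The Laplace transform on `L²((0, ∞); X)`, through its boundary function on the imaginary axis: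
`f` is sent to the Fourier-Plancherel transform of its extension by zero. With the normalisation
`(𝓕 f)(ξ) = ∫ e^{-2πiξt} f(t) dt`, the value at `ξ` is `F(2πiξ)`, where
`F(s) = ∫₀^∞ e^{-st} f(t) dt`. -/
def laplace : L2Half X →ₗᵢ[ℂ] L2Line X :=
  (Lp.fourierTransformₗᵢ ℝ X).toLinearIsometry.comp (extendZero X)

/-- The Hardy space `H₂(X)`, as the closed subspace of boundary functions in `L²(ℝ; X)`. -/
def hardyTwo : Submodule ℂ (L2Line X) := LinearMap.range (laplace X).toLinearMap

instance : CompleteSpace (hardyTwo X) :=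
  ((laplace X).isometry.isUniformInducing.isComplete_range).completeSpace_coe

/-- The Laplace transform as a bijection of `L²((0, ∞); X)` onto `H₂(X)`. -/
def laplaceEquiv : L2Half X ≃ₗ[ℂ] hardyTwo X :=
  LinearEquiv.ofInjective (laplace X).toLinearMap (laplace X).injective

variable {X}

/-- The pointwise product of the boundary function of `g` and `F ∈ L²(ℝ; X)`; the boundary
variable is `s = 2πiξ`. -/
def mulBoundary (g : HInftyMinus) (F : L2Line X) : L2Line X :=
  toL2 volume fun ξ : ℝ => boundaryFun g (2 * Real.pi * ξ) • F ξ

/-- The Toeplitz operator `M_g f = 𝓛⁻¹ (Π (g F))` on `L²((0, ∞); X)`, where `F = 𝓛 f` and `Π` is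
the orthogonal projection onto `H₂(X)`. -/
def toeplitz (g : HInftyMinus) (f : L2Half X) : L2Half X :=
  (laplaceEquiv X).symm ((hardyTwo X).orthogonalProjectionOnto (mulBoundary g (laplace X f)))

/-! ### The operators `g(A)` -/

namespace C0Semigroup

/-- The orbit `T(·) x₀` in `L²((0, ∞); X)`. -/
def orbit (T : C0Semigroup X) (x₀ : X) : L2Half X :=
  toL2 halfLine fun t : ℝ => T.toFun t.toNNReal x₀

/-- The output map `𝔒_g x₀ = M_g (T(·) x₀)`. -/
def outputMapOf (T : C0Semigroup X) (g : HInftyMinus) (x₀ : X) : L2Half X :=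
  toeplitz g (T.orbit x₀)

/-- `G : D(A) → X` is linear, bounded for the graph norm of `D(A)`, and satisfies
`𝔒_g x₀ = G T(·) x₀` for all `x₀ ∈ D(A)`. -/
def Represents (T : C0Semigroup X) (g : HInftyMinus) (G : T.generator.domain →ₗ[ℂ] X) : Prop :=
  (∃ c : ℝ, ∀ x₀ : T.generator.domain, ‖G x₀‖ ≤ c * (‖(x₀ : X)‖ + ‖T.generator x₀‖)) ∧
    ∀ x₀ : T.generator.domain, T.outputMapOf g x₀ =ᵐ[halfLine] T.output G x₀

open Classical in
/-- The operator `g(A) : D(A) → X`: the unique `G` with `T.Represents g G`. -/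
def functionOfGenerator (T : C0Semigroup X) (g : HInftyMinus) : T.generator.domain →ₗ[ℂ] X :=
  if h : ∃ G, T.Represents g G then h.choose else 0

end C0Semigroup

end Toeplitz

end

/-!
Put `O x = C T(·) x`. Exact observability makes `O` an isomorphism of `X` onto a closed subspace of
`L²((0, ∞); Y)`, and `O T(τ)` is the left translation by `τ` after `O`, so this subspace is
invariant under left translations. These are the Toeplitz operators `M_g` with `g(s) = exp (τ s)`.
Every `g ∈ H∞⁻` is obtained from these exponentials by algebraic operations and bounded almost
everywhere limits of boundary functions: `(1 - s)⁻¹` is the limit of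
`τ (1 - exp (τ (s - 1)))⁻¹`, the Cayley transform `(1 + s)/(1 - s)` is affine in it, and a
bounded function on the disc is a limit of its dilations, hence of polynomials. Such limits give
strong limits of Toeplitz operators, so each `M_g` leaves the range of `O` invariant and is carried
by `O` to an operator `Φ g` on `X`. The bound on `‖Φ g‖` follows from `‖M_g‖ ≤ ‖g‖_∞`.

Running the argument for `x ↦ (O x, T(·) x)` gives in addition `M_g (T(·) x) = T(·) Φ g x`, which is
the relation defining `g(A)`. The resolvent is identified by differentiating `Φ (exp (h ·) g)` at
`h = 0`.

Fatou's theorem on the existence of boundary functions comes from a primitive `G` of `g`, which is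
Lipschitz. Where `ω ↦ G(iω)` is differentiable, a Cauchy estimate on the rescaled functions
`s ↦ G(y s)/y`, `y ↓ 0`, gives the horizontal limit of `g`.
-/

noncomputable section

/-! ### Essentially bounded symbols and multiplication operators -/

section Lp

variable {α E : Type*} [MeasurableSpace α] {μ : Measure α} [NormedAddCommGroup E]

theorem coeFn_toL2 {μ : Measure ℝ} {u : ℝ → E} (h : MemLp u 2 μ) : toL2 μ u =ᵐ[μ] u := by
  rw [toL2, dif_pos h]
  exact h.coeFn_toLp

theorem toL2_eq_of_ae_eq {μ : Measure ℝ} {u : ℝ → E} {f : Lp E 2 μ} (h : f =ᵐ[μ] u) :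
    toL2 μ u = f :=
  Lp.ext ((coeFn_toL2 ((memLp_congr_ae h).1 (Lp.memLp f))).trans h.symm)

theorem lp_norm_sq_eq_integral (f : Lp E 2 μ) : ‖f‖ ^ 2 = ∫ x, ‖f x‖ ^ 2 ∂μ := by
  have h := (Lp.memLp f).eLpNorm_eq_integral_rpow_norm two_ne_zero ENNReal.ofNat_ne_top
  have h₀ : 0 ≤ ∫ x, ‖f x‖ ^ (2 : ℝ) ∂μ := integral_nonneg fun x => by positivity
  rw [Lp.norm_def, h, ENNReal.toReal_ofNat, ENNReal.toReal_ofReal (by positivity),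
    ← Real.rpow_natCast, ← Real.rpow_mul h₀]
  simp

theorem tendsto_lp_of_dominated {p : ℝ≥0∞} [Fact (1 ≤ p)] (hp : p ≠ ∞) {ι : Type*} {l : Filter ι}
    [l.IsCountablyGenerated] {F : ι → Lp E p μ} {f : Lp E p μ} {u : ι → α → E} {bound : α → ℝ}
    (hbound : MemLp bound p μ) (hu : ∀ i, F i =ᵐ[μ] u i)
    (hle : ∀ᶠ i in l, ∀ᵐ x ∂μ, ‖u i x‖ ≤ bound x)
    (hlim : ∀ᵐ x ∂μ, Tendsto (fun i => u i x) l (𝓝 (f x))) : Tendsto F l (𝓝 f) := by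
  have hp₀ : p ≠ 0 := (zero_lt_one.trans_le Fact.out).ne'
  have hpos : 0 < p.toReal := ENNReal.toReal_pos hp₀ hp
  have hbound' : MemLp (fun x => ‖bound x‖ + ‖f x‖) p μ := hbound.norm.add (Lp.memLp f).norm
  have hmeas (i : ι) : AEStronglyMeasurable (fun x => u i x - f x) μ :=
    ((Lp.aestronglyMeasurable (F i)).congr (hu i)).sub (Lp.aestronglyMeasurable f)
  have key : Tendsto (fun i => ∫⁻ x, ‖u i x - f x‖ₑ ^ p.toReal ∂μ) l (𝓝 (∫⁻ _, 0 ∂μ)) := by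
    refine tendsto_lintegral_filter_of_dominated_convergence'
      (fun x => ‖‖bound x‖ + ‖f x‖‖ₑ ^ p.toReal) (.of_forall fun i => (hmeas i).enorm.pow_const _)
      ?_ (lintegral_rpow_enorm_lt_top_of_eLpNorm_lt_top hp₀ hp hbound'.2).ne ?_
    · filter_upwards [hle] with i hi
      filter_upwards [hi] with x hx
      gcongr
      rw [enorm_le_iff_norm_le, Real.norm_of_nonneg (by positivity)]
      exact (norm_sub_le _ _).trans (add_le_add_left (hx.trans (le_abs_self _)) _)
    · filter_upwards [hlim] with x hx
      have h₀ : Tendsto (fun i => ‖u i x - f x‖ₑ) l (𝓝 0) := by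
        simpa using (hx.sub_const (f x)).enorm
      simpa [hpos, Function.comp_def] using
        ((ENNReal.continuous_rpow_const (y := p.toReal)).tendsto 0).comp h₀
  rw [Lp.tendsto_Lp_iff_tendsto_eLpNorm']
  have heq (i : ι) : eLpNorm (F i - f : α → E) p μ =
      (∫⁻ x, ‖u i x - f x‖ₑ ^ p.toReal ∂μ) ^ (1 / p.toReal) := by
    rw [← eLpNorm_eq_lintegral_rpow_enorm_toReal hp₀ hp]
    exact eLpNorm_congr_ae ((hu i).sub .rfl)
  simp only [heq]
  simpa [hpos, Function.comp_def] using
    ((ENNReal.continuous_rpow_const (y := 1 / p.toReal)).tendsto _).comp key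

end Lp

section Symbols

variable {α : Type*} [MeasurableSpace α] {μ : Measure α}

variable (μ) in
/-- The algebra of essentially bounded functions `α → ℂ`, used as symbols of multiplication
operators. Its elements are functions, not classes modulo almost everywhere equality, because
`L^∞` carries no ring structure in Mathlib. -/
def essBdd : Subalgebra ℂ (α → ℂ) where
  carrier := {b | MemLp b ∞ μ}
  mul_mem' ha hb := hb.mul ha
  add_mem' := MemLp.add
  algebraMap_mem' := memLp_top_const

theorem mem_essBdd_of_bound {b : α → ℂ} {M : ℝ} (hb : AEStronglyMeasurable b μ)
    (hM : ∀ᵐ x ∂μ, ‖b x‖ ≤ M) : b ∈ essBdd μ :=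
  memLp_top_of_bound hb M hM

/-- Bounded almost everywhere convergence of symbols. -/
def BddTendsto {ι : Type*} (l : Filter ι) (b : ι → essBdd μ) (b₀ : essBdd μ) : Prop :=
  (∃ M : ℝ, ∀ᶠ i in l, ∀ᵐ x ∂μ, ‖(b i : α → ℂ) x‖ ≤ M) ∧
    ∀ᵐ x ∂μ, Tendsto (fun i => (b i : α → ℂ) x) l (𝓝 ((b₀ : α → ℂ) x))

variable {p : ℝ≥0∞} [Fact (1 ≤ p)] {E : Type*} [NormedAddCommGroup E] [NormedSpace ℂ E]

/-- The class of a symbol in `L^∞`. -/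
def essBddToLp : essBdd μ →ₗ[ℂ] Lp ℂ ∞ μ where
  toFun b := MemLp.toLp b b.2
  map_add' _ _ := rfl
  map_smul' _ _ := rfl

variable (p E) in
theorem coeFn_holderL_essBddToLp (b : essBdd μ) (F : Lp E p μ) :
    (ContinuousLinearMap.lsmul ℂ ℂ).holderL μ ∞ p p (essBddToLp b) F
      =ᵐ[μ] fun x => (b : α → ℂ) x • F x := by
  filter_upwards [ContinuousLinearMap.coeFn_holder (r := p) (ContinuousLinearMap.lsmul ℂ ℂ)
    (essBddToLp b) F, MemLp.coeFn_toLp b.2] with x h h'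
  exact h.trans (congrArg (· • F x) h')

variable (p E) in
/-- Multiplication by essentially bounded functions, as a representation on `L^p`. -/
def mulOp : essBdd μ →ₐ[ℂ] (Lp E p μ →L[ℂ] Lp E p μ) :=
  AlgHom.ofLinearMap
    (((ContinuousLinearMap.lsmul ℂ ℂ).holderL μ ∞ p p).toLinearMap ∘ₗ essBddToLp)
    (by
      ext1 F
      refine Lp.ext ((coeFn_holderL_essBddToLp p E 1 F).trans (.of_forall fun x => ?_))
      exact one_smul ℂ _)
    (fun a b => by
      ext1 F
      refine Lp.ext ?_
      filter_upwards [coeFn_holderL_essBddToLp p E (a * b) F, coeFn_holderL_essBddToLp p E b F,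
        coeFn_holderL_essBddToLp p E a
          ((ContinuousLinearMap.lsmul ℂ ℂ).holderL μ ∞ p p (essBddToLp b) F)] with x h₁ h₂ h₃
      refine h₁.trans (Eq.trans ?_ h₃.symm)
      rw [h₂, smul_smul]
      rfl)

theorem coeFn_mulOp (b : essBdd μ) (F : Lp E p μ) :
    mulOp p E b F =ᵐ[μ] fun x => (b : α → ℂ) x • F x :=
  coeFn_holderL_essBddToLp p E b F

theorem norm_mulOp_apply_le (b : essBdd μ) (F : Lp E p μ) {M : ℝ}
    (hM : ∀ᵐ x ∂μ, ‖(b : α → ℂ) x‖ ≤ M) : ‖mulOp p E b F‖ ≤ M * ‖F‖ := by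
  refine Lp.norm_le_mul_norm_of_ae_le_mul ?_
  filter_upwards [hM, coeFn_mulOp b F] with x h h'
  rw [h', norm_smul]
  gcongr

theorem mulOp_eq_of_ae_eq {a b : essBdd μ} (h : (a : α → ℂ) =ᵐ[μ] b) :
    mulOp p E a = mulOp p E b := by
  ext1 F
  refine Lp.ext ?_
  filter_upwards [h, coeFn_mulOp a F, coeFn_mulOp b F] with x h₁ h₂ h₃
  rw [h₂, h₃, h₁]

theorem BddTendsto.mulOp (hp : p ≠ ∞) {ι : Type*} {l : Filter ι} [l.IsCountablyGenerated]
    {b : ι → essBdd μ} {b₀ : essBdd μ} (h : BddTendsto l b b₀) (F : Lp E p μ) :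
    Tendsto (fun i => mulOp p E (b i) F) l (𝓝 (mulOp p E b₀ F)) := by
  obtain ⟨⟨M, hM⟩, hlim⟩ := h
  have hae := coeFn_mulOp b₀ F
  refine tendsto_lp_of_dominated hp ((Lp.memLp F).norm.const_mul M)
    (fun i => coeFn_mulOp (b i) F) ?_ ?_
  · filter_upwards [hM] with i hi
    filter_upwards [hi] with x hx
    rw [norm_smul]
    gcongr
  · filter_upwards [hlim, hae] with x hx h₀
    rw [h₀]
    exact hx.smul_const (F x)

end Symbols

/-! ### Toeplitz operators with bounded symbols -/

/-- `L^∞(ℝ)`, the algebra of symbols on the boundary line. -/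
abbrev essBddLine : Subalgebra ℂ (ℝ → ℂ) := essBdd (volume : Measure ℝ)

/-- The point of the imaginary axis with Fourier variable `ξ`. -/
def boundaryPoint (ξ : ℝ) : ℂ := 2 * Real.pi * ξ * Complex.I

@[fun_prop]
theorem continuous_boundaryPoint : Continuous boundaryPoint := by
  unfold boundaryPoint
  fun_prop

@[simp]
theorem boundaryPoint_re (ξ : ℝ) : (boundaryPoint ξ).re = 0 := by
  simp [boundaryPoint]

/-- The symbol `s ↦ exp (τ s)` on the imaginary axis. -/
def expSymbol (τ : ℝ) : essBddLine :=
  ⟨fun ξ => Complex.exp (τ * boundaryPoint ξ), mem_essBdd_of_bound (M := 1)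
    (by fun_prop : Continuous _).aestronglyMeasurable
    (.of_forall fun ξ => by simp [Complex.norm_exp])⟩

theorem expSymbol_apply (τ ξ : ℝ) :
    (expSymbol τ : ℝ → ℂ) ξ = Complex.exp (τ * boundaryPoint ξ) := rfl

theorem fourier_comp_add_right {E : Type*} [NormedAddCommGroup E] [NormedSpace ℂ E] (f : ℝ → E)
    (τ ξ : ℝ) : FourierTransform.fourier (fun t => f (t + τ)) ξ =
      (expSymbol τ : ℝ → ℂ) ξ • FourierTransform.fourier f ξ := by
  rw [Real.fourier_eq, Real.fourier_eq]
  have h := congrFun (VectorFourier.fourierIntegral_comp_add_right Real.fourierChar volume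
    (innerₗ ℝ) f τ) ξ
  refine h.trans ?_
  rw [Circle.smul_def, Real.fourierChar_apply, expSymbol_apply, boundaryPoint]
  congr 2
  simp only [innerₗ_apply_apply, RCLike.inner_apply, conj_trivial]
  push_cast
  ring

section Translation

variable (X : Type*) [NormedAddCommGroup X] [NormedSpace ℂ X]

/-- Translation `h ↦ h(· + τ)` on `L²(ℝ; X)`. -/
def translateL2 (τ : ℝ) : L2Line X →ₗᵢ[ℂ] L2Line X :=
  Lp.compMeasurePreservingₗᵢ ℂ (fun t => t + τ) (measurePreserving_add_right volume τ)

variable {X}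

theorem ae_comp_add_right {P : ℝ → Prop} (τ : ℝ) (h : ∀ᵐ t, P t) : ∀ᵐ t, P (t + τ) :=
  (measurePreserving_add_right volume τ).quasiMeasurePreserving.ae h

theorem ae_halfLine_comp_add_right {P : ℝ → Prop} {τ : ℝ} (hτ : 0 ≤ τ)
    (h : ∀ᵐ t ∂halfLine, P t) : ∀ᵐ t ∂halfLine, P (t + τ) := by
  rw [ae_restrict_iff' measurableSet_Ioi] at h ⊢
  filter_upwards [ae_comp_add_right τ h] with t h₁ ht
  exact h₁ (add_pos_of_pos_of_nonneg ht hτ)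

theorem frequently_nhdsGT_of_ae_halfLine {p : ℝ → Prop} (h : ∀ᵐ t ∂halfLine, p t) :
    ∃ᶠ t in 𝓝[>] (0 : ℝ), p t := by
  intro hnot
  obtain ⟨ε, hε, hsub⟩ := mem_nhdsGT_iff_exists_Ioo_subset.1 hnot
  have hnull : halfLine (Ioo 0 ε) = 0 := measure_mono_null hsub (ae_iff.1 h)
  rw [Measure.restrict_apply measurableSet_Ioo, inter_eq_left.2 Ioo_subset_Ioi_self,
    Real.volume_Ioo, sub_zero, ENNReal.ofReal_eq_zero] at hnull
  exact hnull.not_gt hε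

theorem coeFn_translateL2 (τ : ℝ) (h : L2Line X) :
    translateL2 X τ h =ᵐ[volume] fun t => h (t + τ) :=
  Lp.coeFn_compMeasurePreserving h (measurePreserving_add_right volume τ)

theorem coeFn_extendZero (f : L2Half X) :
    extendZero X f =ᵐ[volume] (Ioi (0 : ℝ)).indicator f := by
  have h : extendZero X f = MemLp.toLp ((Ioi (0 : ℝ)).indicator f)
    ((memLp_indicator_iff_restrict measurableSet_Ioi).2 (Lp.memLp f)) := rfl
  rw [h]
  exact MemLp.coeFn_toLp _

theorem coeFn_extendZero_halfLine (f : L2Half X) : extendZero X f =ᵐ[halfLine] f := by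
  rw [EventuallyEq, ae_restrict_iff' measurableSet_Ioi]
  filter_upwards [coeFn_extendZero f] with t ht h₀
  rw [ht, indicator_of_mem h₀]

theorem translateL2_toLp (τ : ℝ) (f : SchwartzMap ℝ X) :
    translateL2 X τ (f.toLp 2) = (SchwartzMap.compSubConstCLM ℂ (-τ) f).toLp 2 := by
  refine Lp.ext ?_
  filter_upwards [coeFn_translateL2 τ (f.toLp 2), ae_comp_add_right τ (f.coeFn_toLp 2 volume),
    (SchwartzMap.compSubConstCLM ℂ (-τ) f).coeFn_toLp 2 volume] with t h₁ h₂ h₃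
  rw [h₁, h₂, h₃, SchwartzMap.compSubConstCLM_apply, sub_neg_eq_add]

end Translation

section Toeplitz

variable {X : Type*} [NormedAddCommGroup X] [InnerProductSpace ℂ X] [CompleteSpace X]

theorem fourier_translateL2_toLp (τ : ℝ) (f : SchwartzMap ℝ X) :
    Lp.fourierTransformₗᵢ ℝ X (translateL2 X τ (f.toLp 2)) =
      mulOp 2 X (expSymbol τ) (Lp.fourierTransformₗᵢ ℝ X (f.toLp 2)) := by
  have hfourier (k : SchwartzMap ℝ X) : Lp.fourierTransformₗᵢ ℝ X (k.toLp 2) =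
      (FourierTransform.fourier k).toLp 2 := SchwartzMap.toLp_fourier_eq k
  rw [translateL2_toLp, hfourier, hfourier]
  refine Lp.ext ?_
  filter_upwards [coeFn_mulOp (expSymbol τ) ((FourierTransform.fourier f).toLp 2),
    (FourierTransform.fourier f).coeFn_toLp 2 volume,
    (FourierTransform.fourier (SchwartzMap.compSubConstCLM ℂ (-τ) f)).coeFn_toLp 2 volume]
    with ξ h₁ h₂ h₃
  rw [h₁, h₂, h₃, SchwartzMap.fourier_coe, SchwartzMap.fourier_coe, ← fourier_comp_add_right]
  refine congrArg (fun k : ℝ → X => FourierTransform.fourier k ξ) (funext fun t => ?_)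
  rw [SchwartzMap.compSubConstCLM_apply, sub_neg_eq_add]

theorem fourier_translateL2 (τ : ℝ) (h : L2Line X) :
    Lp.fourierTransformₗᵢ ℝ X (translateL2 X τ h) =
      mulOp 2 X (expSymbol τ) (Lp.fourierTransformₗᵢ ℝ X h) := by
  have hdense : DenseRange (SchwartzMap.toLpCLM ℝ X 2 (volume : Measure ℝ)) :=
    SchwartzMap.denseRange_toLpCLM ENNReal.ofNat_ne_top
  refine hdense.induction_on (p := fun h =>
    Lp.fourierTransformₗᵢ ℝ X (translateL2 X τ h) =
      mulOp 2 X (expSymbol τ) (Lp.fourierTransformₗᵢ ℝ X h)) h ?_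
    (fourier_translateL2_toLp τ)
  exact isClosed_eq
    ((Lp.fourierTransformₗᵢ ℝ X).continuous.comp (translateL2 X τ).continuous)
    ((mulOp 2 X (expSymbol τ)).continuous.comp (Lp.fourierTransformₗᵢ ℝ X).continuous)

variable (X) in
/-- The adjoint of the Laplace transform `L²((0, ∞); X) → L²(ℝ; X)`. -/
def laplaceAdj : L2Line X →L[ℂ] L2Half X :=
  (laplace X).toContinuousLinearMap.adjoint

theorem laplaceAdj_laplace (f : L2Half X) : laplaceAdj X (laplace X f) = f := by
  refine ext_inner_left ℂ fun u => ?_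
  rw [laplaceAdj, ContinuousLinearMap.adjoint_inner_right]
  exact (laplace X).inner_map_map u f

theorem norm_laplaceAdj_le (F : L2Line X) : ‖laplaceAdj X F‖ ≤ ‖F‖ := by
  refine (ContinuousLinearMap.le_opNorm _ _).trans (mul_le_of_le_one_left (norm_nonneg _) ?_)
  rw [laplaceAdj, LinearIsometryEquiv.norm_map]
  exact (laplace X).norm_toContinuousLinearMap_le

theorem symm_ofInjective_orthogonalProjectionOnto {E F : Type*}
    [NormedAddCommGroup E] [InnerProductSpace ℂ E] [CompleteSpace E]
    [NormedAddCommGroup F] [InnerProductSpace ℂ F] [CompleteSpace F] (L : E →ₗᵢ[ℂ] F)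
    [(LinearMap.range L.toLinearMap).HasOrthogonalProjection] (v : F) :
    (LinearEquiv.ofInjective L.toLinearMap L.injective).symm
      ((LinearMap.range L.toLinearMap).orthogonalProjectionOnto v) =
      L.toContinuousLinearMap.adjoint v := by
  rw [LinearEquiv.symm_apply_eq]
  refine Subtype.ext ?_
  refine Submodule.eq_starProjection_of_mem_of_inner_eq_zero (Subtype.prop _) ?_
  rintro _ ⟨u, rfl⟩
  have hadj := ContinuousLinearMap.adjoint_inner_left (𝕜 := ℂ) L.toContinuousLinearMap u v
  refine (inner_sub_left _ _ _).trans ?_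
  exact sub_eq_zero.2 (hadj.symm.trans (L.inner_map_map _ _).symm)

theorem laplaceEquiv_symm_orthogonalProjectionOnto (F : L2Line X) :
    (laplaceEquiv X).symm ((hardyTwo X).orthogonalProjectionOnto F) = laplaceAdj X F :=
  haveI : (LinearMap.range (laplace X).toLinearMap).HasOrthogonalProjection :=
    inferInstanceAs (hardyTwo X).HasOrthogonalProjection
  symm_ofInjective_orthogonalProjectionOnto (laplace X) F

theorem laplaceAdj_fourier (h : L2Line X) : laplaceAdj X (Lp.fourierTransformₗᵢ ℝ X h) =
    LpToLpRestrictCLM ℝ X ℂ volume 2 (Ioi 0) h := by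
  refine ext_inner_left ℂ fun u => ?_
  rw [laplaceAdj, ContinuousLinearMap.adjoint_inner_right]
  refine ((Lp.fourierTransformₗᵢ ℝ X).inner_map_map (extendZero X u) h).trans ?_
  have hrestrict : inner ℂ u (LpToLpRestrictCLM ℝ X ℂ volume 2 (Ioi 0) h) =
      ∫ t in Ioi 0, inner ℂ (u t) (h t) := by
    rw [L2.inner_def]
    refine integral_congr_ae ?_
    filter_upwards [LpToLpRestrictCLM_coeFn ℂ (Ioi 0) h] with t ht
    rw [ht]
  rw [hrestrict, L2.inner_def, ← integral_indicator measurableSet_Ioi]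
  refine integral_congr_ae ?_
  filter_upwards [coeFn_extendZero u] with t ht
  rw [ht]
  by_cases hmem : t ∈ Ioi (0 : ℝ)
  · simp only [indicator_of_mem hmem]
  · simp only [indicator_of_notMem hmem, inner_zero_left]

theorem coeFn_laplaceAdj_fourier (h : L2Line X) :
    laplaceAdj X (Lp.fourierTransformₗᵢ ℝ X h) =ᵐ[halfLine] h := by
  rw [laplaceAdj_fourier]
  exact LpToLpRestrictCLM_coeFn ℂ (Ioi 0) h

theorem coeFn_laplaceAdj_mulOp_expSymbol (τ : ℝ) (h : L2Line X) :
    laplaceAdj X (mulOp 2 X (expSymbol τ) (Lp.fourierTransformₗᵢ ℝ X h))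
      =ᵐ[halfLine] fun t => h (t + τ) := by
  rw [← fourier_translateL2]
  exact (coeFn_laplaceAdj_fourier _).trans (ae_restrict_of_ae (coeFn_translateL2 τ h))

variable (X) in
/-- The Toeplitz operator on `L²((0, ∞); X)` with an arbitrary bounded symbol: `toeplitz g` is the
case where the symbol is the boundary function of `g`. -/
def toeplitzOp : essBddLine →ₗ[ℂ] (L2Half X →L[ℂ] L2Half X) where
  toFun b := laplaceAdj X ∘L mulOp 2 X b ∘L (laplace X).toContinuousLinearMap
  map_add' a b := by simp only [map_add, ContinuousLinearMap.add_comp, ContinuousLinearMap.comp_add]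
  map_smul' c b := by
    simp only [map_smul, ContinuousLinearMap.smul_comp, ContinuousLinearMap.comp_smul,
      RingHom.id_apply]

theorem toeplitzOp_apply (b : essBddLine) (f : L2Half X) :
    toeplitzOp X b f = laplaceAdj X (mulOp 2 X b (laplace X f)) := rfl

theorem toeplitzOp_one : toeplitzOp X 1 = 1 := by
  ext1 f
  rw [toeplitzOp_apply, map_one, one_apply_eq_self, laplaceAdj_laplace, one_apply_eq_self]

theorem norm_toeplitzOp_apply_le (b : essBddLine) (f : L2Half X) {M : ℝ}
    (hM : ∀ᵐ ξ, ‖(b : ℝ → ℂ) ξ‖ ≤ M) : ‖toeplitzOp X b f‖ ≤ M * ‖f‖ :=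
  calc ‖toeplitzOp X b f‖ ≤ ‖mulOp 2 X b (laplace X f)‖ := norm_laplaceAdj_le _
    _ ≤ M * ‖laplace X f‖ := norm_mulOp_apply_le b _ hM
    _ = M * ‖f‖ := by rw [LinearIsometry.norm_map]

theorem BddTendsto.toeplitzOp {ι : Type*} {l : Filter ι} [l.IsCountablyGenerated]
    {b : ι → essBddLine} {b₀ : essBddLine} (h : BddTendsto l b b₀) (f : L2Half X) :
    Tendsto (fun i => toeplitzOp X (b i) f) l (𝓝 (toeplitzOp X b₀ f)) :=
  ((laplaceAdj X).continuous.tendsto _).comp (h.mulOp ENNReal.ofNat_ne_top _)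

theorem coeFn_toeplitzOp_expSymbol {τ : ℝ} (hτ : 0 ≤ τ) (f : L2Half X) :
    toeplitzOp X (expSymbol τ) f =ᵐ[halfLine] fun t => f (t + τ) :=
  (coeFn_laplaceAdj_mulOp_expSymbol τ (extendZero X f)).trans
    (ae_halfLine_comp_add_right hτ (coeFn_extendZero_halfLine f))

variable (X) in
/-- The symbols whose multiplication operator leaves the orthogonal complement of `H₂(X)`
invariant. On these the map from symbols to Toeplitz operators is multiplicative. -/
def coanalyticSymbols : Subalgebra ℂ essBddLine where
  carrier := {b | ∀ F : L2Line X, laplaceAdj X F = 0 → laplaceAdj X (mulOp 2 X b F) = 0}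
  mul_mem' := by
    intro a b ha hb F hF
    rw [map_mul]
    exact ha _ (hb _ hF)
  add_mem' := by
    intro a b ha hb F hF
    rw [map_add, add_apply, map_add, ha F hF, hb F hF, add_zero]
  algebraMap_mem' := by
    intro c F hF
    rw [AlgHom.commutes, Algebra.algebraMap_eq_smul_one, smul_apply, map_smul,
      one_apply_eq_self, hF, smul_zero]

theorem toeplitzOp_mul {a : essBddLine} (ha : a ∈ coanalyticSymbols X) (b : essBddLine) :
    toeplitzOp X (a * b) = toeplitzOp X a * toeplitzOp X b := by
  ext1 f
  rw [mul_apply_eq_comp, toeplitzOp_apply, map_mul, mul_apply_eq_comp, toeplitzOp_apply a,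
    ← sub_eq_zero, ← map_sub, ← map_sub]
  refine ha _ ?_
  rw [map_sub, toeplitzOp_apply, laplaceAdj_laplace, sub_self]

theorem expSymbol_mem_coanalyticSymbols {τ : ℝ} (hτ : 0 ≤ τ) :
    expSymbol τ ∈ coanalyticSymbols X := by
  intro F hF
  obtain ⟨h, rfl⟩ := (Lp.fourierTransformₗᵢ ℝ X).surjective F
  have hzero : (h : ℝ → X) =ᵐ[halfLine] 0 :=
    (coeFn_laplaceAdj_fourier h).symm.trans (Lp.eq_zero_iff_ae_eq_zero.1 hF)
  exact Lp.eq_zero_iff_ae_eq_zero.2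
    ((coeFn_laplaceAdj_mulOp_expSymbol τ h).trans (ae_halfLine_comp_add_right hτ hzero))

end Toeplitz

/-! ### Fatou's theorem -/

section Cayley

/-- The Cayley transform of the unit disc onto the left half-plane. -/
def discToPlane (w : ℂ) : ℂ := (w - 1) / (w + 1)

/-- The inverse Cayley transform, of the left half-plane onto the unit disc. -/
def planeToDisc (s : ℂ) : ℂ := (1 + s) / (1 - s)

theorem one_sub_ne_zero_of_re_nonpos {s : ℂ} (hs : s.re ≤ 0) : 1 - s ≠ 0 := by
  intro h
  have hre : s.re = 1 := by rw [← sub_eq_zero.1 h, Complex.one_re]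
  linarith

theorem add_one_ne_zero_of_norm_lt_one {w : ℂ} (hw : ‖w‖ < 1) : w + 1 ≠ 0 := by
  intro h
  rw [eq_neg_of_add_eq_zero_left h, norm_neg, norm_one] at hw
  exact lt_irrefl _ hw

theorem planeToDisc_add_one {s : ℂ} (hs : s.re ≤ 0) : planeToDisc s + 1 = 2 / (1 - s) := by
  have h := one_sub_ne_zero_of_re_nonpos hs
  rw [planeToDisc]
  field_simp
  ring

theorem discToPlane_planeToDisc {s : ℂ} (hs : s.re ≤ 0) : discToPlane (planeToDisc s) = s := by
  have h := one_sub_ne_zero_of_re_nonpos hs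
  rw [discToPlane, planeToDisc_add_one hs, planeToDisc]
  field_simp
  ring

theorem norm_one_sub_sq (s : ℂ) : ‖1 - s‖ ^ 2 = ‖1 + s‖ ^ 2 - 4 * s.re := by
  simp only [Complex.sq_norm, Complex.normSq_apply, Complex.sub_re, Complex.sub_im, Complex.add_re,
    Complex.add_im, Complex.one_re, Complex.one_im]
  ring

theorem norm_planeToDisc_lt_one {s : ℂ} (hs : s.re < 0) : ‖planeToDisc s‖ < 1 := by
  rw [planeToDisc, norm_div, div_lt_one (norm_pos_iff.2 (one_sub_ne_zero_of_re_nonpos hs.le))]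
  refine lt_of_pow_lt_pow_left₀ 2 (norm_nonneg _) ?_
  rw [norm_one_sub_sq]
  linarith

theorem norm_planeToDisc_le_one {s : ℂ} (hs : s.re ≤ 0) : ‖planeToDisc s‖ ≤ 1 := by
  rw [planeToDisc, norm_div, div_le_one (norm_pos_iff.2 (one_sub_ne_zero_of_re_nonpos hs))]
  refine le_of_sq_le_sq ?_ (norm_nonneg _)
  rw [norm_one_sub_sq]
  linarith

theorem discToPlane_re (w : ℂ) : (discToPlane w).re = (‖w‖ ^ 2 - 1) / ‖w + 1‖ ^ 2 := by
  rw [discToPlane, Complex.div_re, Complex.sq_norm, Complex.sq_norm, Complex.normSq_apply w]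
  simp only [Complex.sub_re, Complex.sub_im, Complex.add_re, Complex.add_im, Complex.one_re,
    Complex.one_im]
  ring

theorem discToPlane_re_neg {w : ℂ} (hw : ‖w‖ < 1) : (discToPlane w).re < 0 := by
  rw [discToPlane_re]
  refine div_neg_of_neg_of_pos ?_ (pow_pos (norm_pos_iff.2 (add_one_ne_zero_of_norm_lt_one hw)) 2)
  nlinarith [norm_nonneg w]

theorem discToPlane_eq_im_mul_I {w : ℂ} (hw : ‖w‖ = 1) :
    discToPlane w = (discToPlane w).im * Complex.I := by
  refine Complex.ext ?_ (by simp)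
  rw [discToPlane_re, hw]
  simp

theorem hasDerivAt_discToPlane {w : ℂ} (hw : w + 1 ≠ 0) :
    HasDerivAt discToPlane (2 / (w + 1) ^ 2) w := by
  refine (((hasDerivAt_id w).sub_const 1).div ((hasDerivAt_id w).add_const 1) hw).congr_deriv ?_
  simp only [id]
  ring

theorem hasDerivAt_planeToDisc {s : ℂ} (hs : s.re ≤ 0) :
    HasDerivAt planeToDisc (2 / (1 - s) ^ 2) s := by
  refine (((hasDerivAt_id s).const_add 1).div ((hasDerivAt_id s).const_sub 1)
    (one_sub_ne_zero_of_re_nonpos hs)).congr_deriv ?_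
  simp only [id]
  ring

end Cayley

section Primitive

variable {g : ℂ → ℂ}

theorem isOpen_setOf_re_neg : IsOpen {s : ℂ | s.re < 0} :=
  isOpen_lt Complex.continuous_re continuous_const

theorem differentiableAt_comp_discToPlane (hg : DifferentiableOn ℂ g {s | s.re < 0}) {w : ℂ}
    (hw : ‖w‖ < 1) : DifferentiableAt ℂ (fun w => g (discToPlane w)) w :=
  (hg.differentiableAt (isOpen_setOf_re_neg.mem_nhds (discToPlane_re_neg hw))).comp w
    (hasDerivAt_discToPlane (add_one_ne_zero_of_norm_lt_one hw)).differentiableAt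

theorem exists_hasDerivAt_of_re_neg (hg : DifferentiableOn ℂ g {s | s.re < 0}) :
    ∃ G : ℂ → ℂ, ∀ s : ℂ, s.re < 0 → HasDerivAt G (g s) s := by
  have hdisc : DifferentiableOn ℂ (fun w => g (discToPlane w) * (2 / (w + 1) ^ 2))
      (Metric.ball 0 1) := by
    intro w hw
    rw [mem_ball_zero_iff] at hw
    have hne : (w + 1) ^ 2 ≠ 0 := pow_ne_zero 2 (add_one_ne_zero_of_norm_lt_one hw)
    exact ((differentiableAt_comp_discToPlane hg hw).mul
      (by fun_prop (disch := exact hne))).differentiableWithinAt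
  obtain ⟨F, hF⟩ := hdisc.isExactOn_ball
  refine ⟨F ∘ planeToDisc, fun s hs => ?_⟩
  have h := one_sub_ne_zero_of_re_nonpos hs.le
  refine ((hF _ (mem_ball_zero_iff.2 (norm_planeToDisc_lt_one hs))).comp s
    (hasDerivAt_planeToDisc hs.le)).congr_deriv ?_
  simp only [discToPlane_planeToDisc hs.le, planeToDisc_add_one hs.le]
  field_simp

theorem exists_lipschitzWith_hasDerivAt_of_re_neg (hg : DifferentiableOn ℂ g {s | s.re < 0})
    {M : ℝ} (hM : ∀ s : ℂ, s.re < 0 → ‖g s‖ ≤ M) :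
    ∃ (K : ℝ≥0) (G : ℂ → ℂ), LipschitzWith K G ∧ ∀ s : ℂ, s.re < 0 → HasDerivAt G (g s) s := by
  obtain ⟨G, hG⟩ := exists_hasDerivAt_of_re_neg hg
  have hlip : LipschitzOnWith M.toNNReal G {s : ℂ | s.re < 0} := by
    refine (convex_halfSpace_re_lt 0).lipschitzOnWith_of_nnnorm_hasDerivWithin_le
      (fun s hs => (hG s hs).hasDerivWithinAt) fun s hs => ?_
    rw [← NNReal.coe_le_coe, coe_nnnorm]
    exact (hM s hs).trans (Real.le_coe_toNNReal M)
  obtain ⟨G', hG', heq⟩ := hlip.extend_finite_dimension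
  refine ⟨_, G', hG', fun s hs => (hG s hs).congr_of_eventuallyEq ?_⟩
  filter_upwards [isOpen_setOf_re_neg.mem_nhds hs] with z hz
  exact (heq hz).symm

end Primitive

section Fatou

theorem norm_deriv_zero_le_integral_norm {k : ℂ → ℂ} (hk : DiffContOnCl ℂ k (Metric.ball 0 1)) :
    2 * Real.pi * ‖deriv k 0‖ ≤ ∫ θ in (0 : ℝ)..2 * Real.pi, ‖k (circleMap 0 1 θ)‖ := by
  have hcauchy := hk.circleIntegral_one_div_sub_center_pow_smul one_pos (n := 1)
  calc 2 * Real.pi * ‖deriv k 0‖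
      = ‖∮ z in C(0, 1), (1 / (z - 0) ^ (1 + 1)) • k z‖ := by
        rw [hcauchy, norm_smul, iteratedDeriv_one]
        simp [abs_of_pos Real.pi_pos]
    _ ≤ ∫ θ in (0 : ℝ)..2 * Real.pi, ‖deriv (circleMap 0 1) θ •
          (1 / (circleMap 0 1 θ - 0) ^ (1 + 1)) • k (circleMap 0 1 θ)‖ :=
        intervalIntegral.norm_integral_le_integral_norm Real.two_pi_pos.le
    _ = ∫ θ in (0 : ℝ)..2 * Real.pi, ‖k (circleMap 0 1 θ)‖ :=
        intervalIntegral.integral_congr fun θ _ => by simp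

/-- The function on the unit disc obtained from `s ↦ H (y s) / y` by the Cayley transform. The
weight `(1 - w²)²` makes it continuous at `w = -1`, and the derivative of the weight vanishes at
`w = 0`. -/
def cayleyRescale (H : ℂ → ℂ) (y : ℝ) (w : ℂ) : ℂ :=
  H (y * discToPlane w) / y * (1 - w ^ 2) ^ 2

variable {H h : ℂ → ℂ} {K : ℝ≥0} {y : ℝ}

theorem norm_cayleyRescale_le (hH : LipschitzWith K H) (h₀ : H 0 = 0) (hy : 0 < y) (w : ℂ) :
    ‖cayleyRescale H y w‖ ≤ K * (‖w - 1‖ ^ 3 * ‖w + 1‖) := by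
  by_cases hw : w + 1 = 0
  · rw [cayleyRescale, show 1 - w ^ 2 = (1 - w) * (w + 1) by ring, hw]
    simp
  · have hdiv : ‖H (y * discToPlane w) / y‖ ≤ K * (‖w - 1‖ / ‖w + 1‖) := by
      have hlip := hH.dist_le_mul (y * discToPlane w) 0
      rw [h₀, dist_zero_right, dist_zero_right, norm_mul, Complex.norm_of_nonneg hy.le,
        discToPlane, norm_div] at hlip
      rw [norm_div, Complex.norm_of_nonneg hy.le, div_le_iff₀ hy, discToPlane]
      linarith
    calc ‖cayleyRescale H y w‖
        = ‖H (y * discToPlane w) / y‖ * (‖w - 1‖ * ‖w + 1‖) ^ 2 := by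
          rw [cayleyRescale, norm_mul, norm_pow, ← norm_mul, ← norm_neg (1 - w ^ 2)]
          ring_nf
      _ ≤ K * (‖w - 1‖ / ‖w + 1‖) * (‖w - 1‖ * ‖w + 1‖) ^ 2 := by gcongr
      _ = K * (‖w - 1‖ ^ 3 * ‖w + 1‖) := by
          have := norm_ne_zero_iff.2 hw
          field_simp

theorem norm_cayleyRescale_le_of_norm_eq_one (hH : LipschitzWith K H) (h₀ : H 0 = 0) (hy : 0 < y)
    {w : ℂ} (hw : ‖w‖ = 1) : ‖cayleyRescale H y w‖ ≤ K * (2 ^ 3 * 2) := by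
  refine (norm_cayleyRescale_le hH h₀ hy w).trans ?_
  gcongr
  · exact (norm_sub_le _ _).trans_eq (by rw [hw, norm_one]; norm_num)
  · exact (norm_add_le _ _).trans_eq (by rw [hw, norm_one]; norm_num)

theorem continuous_cayleyRescale (hH : LipschitzWith K H) (h₀ : H 0 = 0) (hy : 0 < y) :
    Continuous (cayleyRescale H y) := by
  rw [continuous_iff_continuousAt]
  intro w
  by_cases hw : w + 1 = 0
  · have hw' : w = -1 := eq_neg_of_add_eq_zero_left hw
    have hzero : cayleyRescale H y w = 0 := by simp [cayleyRescale, hw']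
    rw [ContinuousAt, hzero]
    refine squeeze_zero_norm (norm_cayleyRescale_le hH h₀ hy) ?_
    have hcont : Continuous fun w : ℂ => (K : ℝ) * (‖w - 1‖ ^ 3 * ‖w + 1‖) := by fun_prop
    simpa [hw] using hcont.tendsto w
  · have hcont : ContinuousAt (fun w => H (y * discToPlane w)) w :=
      ContinuousAt.comp (f := fun w => (y : ℂ) * discToPlane w) hH.continuous.continuousAt
        (continuousAt_const.mul (hasDerivAt_discToPlane hw).continuousAt)
    exact (hcont.div_const _).mul (by fun_prop)

theorem hasDerivAt_cayleyRescale (hd : ∀ s : ℂ, s.re < 0 → HasDerivAt H (h s) s) (hy : 0 < y)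
    {w : ℂ} (hw : ‖w‖ < 1) :
    HasDerivAt (cayleyRescale H y)
      (h (y * discToPlane w) * (2 / (w + 1) ^ 2) * (1 - w ^ 2) ^ 2 +
        H (y * discToPlane w) / y * (2 * (1 - w ^ 2) * -(2 * w))) w := by
  have hre : ((y : ℂ) * discToPlane w).re < 0 := by
    rw [Complex.re_ofReal_mul]
    exact mul_neg_of_pos_of_neg hy (discToPlane_re_neg hw)
  have hcomp : HasDerivAt (fun w => H (y * discToPlane w) / y)
      (h (y * discToPlane w) * (2 / (w + 1) ^ 2)) w := by
    refine ((HasDerivAt.comp (h := fun w => (y : ℂ) * discToPlane w) w (hd _ hre)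
      ((hasDerivAt_discToPlane (add_one_ne_zero_of_norm_lt_one hw)).const_mul _)).div_const
        (y : ℂ)).congr_deriv ?_
    have : (y : ℂ) ≠ 0 := Complex.ofReal_ne_zero.2 hy.ne'
    field_simp
  have hweight : HasDerivAt (fun w : ℂ => (1 - w ^ 2) ^ 2) (2 * (1 - w ^ 2) * -(2 * w)) w := by
    simpa using (((hasDerivAt_id w).fun_pow 2).const_sub 1).fun_pow 2
  exact hcomp.mul hweight

theorem norm_le_integral_norm_cayleyRescale (hH : LipschitzWith K H) (h₀ : H 0 = 0)
    (hd : ∀ s : ℂ, s.re < 0 → HasDerivAt H (h s) s) (hy : 0 < y) :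
    ‖h (-y)‖ ≤ ∫ θ in (0 : ℝ)..2 * Real.pi, ‖cayleyRescale H y (circleMap 0 1 θ)‖ := by
  have hcl : DiffContOnCl ℂ (cayleyRescale H y) (Metric.ball 0 1) :=
    ⟨fun w hw => (hasDerivAt_cayleyRescale hd hy
      (mem_ball_zero_iff.1 hw)).differentiableAt.differentiableWithinAt,
      (continuous_cayleyRescale hH h₀ hy).continuousOn⟩
  have hderiv : deriv (cayleyRescale H y) 0 = h (-y) * 2 := by
    rw [(hasDerivAt_cayleyRescale hd hy (w := 0) (by simp)).deriv]
    simp [discToPlane]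
  refine le_trans ?_ (norm_deriv_zero_le_integral_norm hcl)
  rw [hderiv, norm_mul, Complex.norm_ofNat]
  nlinarith [Real.pi_gt_three, norm_nonneg (h (-y))]

theorem tendsto_cayleyRescale (h₀ : H 0 = 0)
    (hI : HasDerivAt (fun t : ℝ => H (t * Complex.I)) 0 0) {w : ℂ} (hw : ‖w‖ = 1) :
    Tendsto (fun y : ℝ => cayleyRescale H y w) (𝓝[>] 0) (𝓝 0) := by
  obtain ⟨t, ht⟩ : ∃ t : ℝ, discToPlane w = t * Complex.I := ⟨_, discToPlane_eq_im_mul_I hw⟩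
  have hderiv : HasDerivAt (fun y : ℝ => H ((y * t : ℝ) * Complex.I)) 0 0 := by
    have hlin : HasDerivAt (fun y : ℝ => y * t) (1 * t) 0 := (hasDerivAt_id (0 : ℝ)).mul_const t
    have hI' : HasDerivAt (fun t : ℝ => H (t * Complex.I)) 0 (0 * t) := by rwa [zero_mul]
    simpa [Function.comp_def] using hI'.scomp (0 : ℝ) hlin
  have hslope := (hderiv.tendsto_slope.mono_left
    (nhdsWithin_mono 0 fun y (hy : 0 < y) => hy.ne')).mul_const ((1 - w ^ 2) ^ 2)
  rw [zero_mul] at hslope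
  refine hslope.congr fun y => ?_
  simp only [cayleyRescale, slope, ht, vsub_eq_sub, sub_zero, zero_mul, Complex.ofReal_zero, h₀,
    Complex.real_smul, Complex.ofReal_inv, Complex.ofReal_mul]
  ring_nf

theorem tendsto_of_hasDerivAt_zero (hH : LipschitzWith K H) (h₀ : H 0 = 0)
    (hd : ∀ s : ℂ, s.re < 0 → HasDerivAt H (h s) s)
    (hI : HasDerivAt (fun t : ℝ => H (t * Complex.I)) 0 0) :
    Tendsto (fun r : ℝ => h r) (𝓝[<] 0) (𝓝 0) := by
  have hintegral : Tendsto (fun y : ℝ => ∫ θ in (0 : ℝ)..2 * Real.pi,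
      ‖cayleyRescale H y (circleMap 0 1 θ)‖) (𝓝[>] 0)
      (𝓝 (∫ _ in (0 : ℝ)..2 * Real.pi, (0 : ℝ))) := by
    refine intervalIntegral.tendsto_integral_filter_of_dominated_convergence
      (fun _ => (K : ℝ) * (2 ^ 3 * 2)) ?_ ?_ intervalIntegrable_const (.of_forall fun θ _ => ?_)
    · filter_upwards [self_mem_nhdsWithin] with y hy
      exact ((continuous_cayleyRescale hH h₀ hy).comp
        (continuous_circleMap 0 1)).norm.aestronglyMeasurable
    · filter_upwards [self_mem_nhdsWithin] with y hy
      refine .of_forall fun θ _ => ?_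
      rw [norm_norm]
      exact norm_cayleyRescale_le_of_norm_eq_one hH h₀ hy (by simp)
    · simpa using (tendsto_cayleyRescale h₀ hI (w := circleMap 0 1 θ) (by simp)).norm
  rw [intervalIntegral.integral_zero] at hintegral
  have hneg : Tendsto (fun r : ℝ => -r) (𝓝[<] 0) (𝓝[>] 0) := by
    simpa using tendsto_neg_nhdsLT (a := (0 : ℝ))
  refine squeeze_zero_norm' ?_ (hintegral.comp hneg)
  filter_upwards [self_mem_nhdsWithin] with r hr
  simpa using norm_le_integral_norm_cayleyRescale hH h₀ hd (neg_pos.2 hr)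

theorem tendsto_of_hasDerivAt_mul_I (hH : LipschitzWith K H)
    (hd : ∀ s : ℂ, s.re < 0 → HasDerivAt H (h s) s) {c : ℂ}
    (hI : HasDerivAt (fun t : ℝ => H (t * Complex.I)) (c * Complex.I) 0) :
    Tendsto (fun r : ℝ => h r) (𝓝[<] 0) (𝓝 c) := by
  have hlip : LipschitzWith (K + 0 + ‖c‖₊) fun s => H s - H 0 - c * s :=
    (hH.sub (.const _)).sub (ContinuousLinearMap.mul ℂ ℂ c |>.lipschitzWith_of_opNorm_le (by simp))
  have hlin : HasDerivAt (fun t : ℝ => c * (t * Complex.I)) (c * Complex.I) 0 := by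
    simpa using ((Complex.ofRealCLM.hasDerivAt (x := (0 : ℝ))).mul_const Complex.I).const_mul c
  have hzero : Tendsto (fun r : ℝ => h r - c) (𝓝[<] 0) (𝓝 0) := by
    refine tendsto_of_hasDerivAt_zero (h := fun s => h s - c) hlip (by simp) (fun s hs => ?_) ?_
    · simpa using ((hd s hs).sub_const (H 0)).fun_sub ((hasDerivAt_id s).const_mul c)
    · simpa using (hI.sub_const (H 0)).fun_sub hlin
  simpa using hzero.add_const c

theorem ae_exists_tendsto_of_re_neg {g : ℂ → ℂ} (hg : DifferentiableOn ℂ g {s | s.re < 0}) {M : ℝ}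
    (hM : ∀ s : ℂ, s.re < 0 → ‖g s‖ ≤ M) :
    ∀ᵐ ω : ℝ, ∃ c, Tendsto (fun r : ℝ => g (r + ω * Complex.I)) (𝓝[<] 0) (𝓝 c) := by
  obtain ⟨K, G, hG, hd⟩ := exists_lipschitzWith_hasDerivAt_of_re_neg hg hM
  have hlip : LipschitzWith (K * 1) fun ω : ℝ => G (ω * Complex.I) :=
    hG.comp (.of_dist_le_mul fun a b => by simp [dist_eq_norm, ← sub_mul, ← Complex.ofReal_sub])
  filter_upwards [hlip.ae_differentiableAt_real] with ω hω
  refine ⟨deriv (fun ω : ℝ => G (ω * Complex.I)) ω / Complex.I,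
    tendsto_of_hasDerivAt_mul_I (K := K) (H := fun s => G (s + ω * Complex.I))
      (h := fun s => g (s + ω * Complex.I))
      (.of_dist_le_mul fun a b => by
        simpa using hG.dist_le_mul (a + ω * Complex.I) (b + ω * Complex.I))
      (fun s hs => (hd _ (by simpa using hs)).comp_add_const s _) ?_⟩
  rw [div_mul_cancel₀ _ Complex.I_ne_zero]
  have hshift := HasDerivAt.comp_add_const (0 : ℝ) ω
    (f := fun ω : ℝ => G (ω * Complex.I)) (by simpa only [zero_add] using hω.hasDerivAt)
  simpa [add_mul] using hshift

end Fatou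

/-! ### Boundary functions and generation by exponentials -/

section BddClosed

variable {α : Type*} [MeasurableSpace α] {μ : Measure α}

/-- Closedness of a set of symbols under bounded almost everywhere convergence of sequences. -/
def IsBddClosed (A : Set (essBdd μ)) : Prop :=
  ∀ ⦃b : ℕ → essBdd μ⦄ ⦃b₀ : essBdd μ⦄, BddTendsto atTop b b₀ → (∀ n, b n ∈ A) → b₀ ∈ A

theorem IsBddClosed.inter {A B : Set (essBdd μ)} (hA : IsBddClosed A) (hB : IsBddClosed B) :
    IsBddClosed (A ∩ B) :=
  fun _ _ h hb => ⟨hA h fun n => (hb n).1, hB h fun n => (hb n).2⟩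

theorem isBddClosed_coanalyticSymbols (X : Type*) [NormedAddCommGroup X] [InnerProductSpace ℂ X]
    [CompleteSpace X] : IsBddClosed (coanalyticSymbols X : Set essBddLine) := by
  intro b b₀ h hb F hF
  refine tendsto_nhds_unique
    (((laplaceAdj X).continuous.tendsto _).comp (h.mulOp ENNReal.ofNat_ne_top F))
    (tendsto_const_nhds.congr fun n => ?_)
  exact (hb n F hF).symm

variable {A : Subalgebra ℂ (essBdd μ)}

theorem IsBddClosed.mem_map_of_tendsto (hA : IsBddClosed (A : Set (essBdd μ))) {ι : Type*}
    {l : Filter ι} [l.NeBot] [l.IsCountablyGenerated] {f : ι → α → ℂ} {f₀ : α → ℂ} {M : ℝ}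
    (hf : ∀ᶠ i in l, f i ∈ A.map (essBdd μ).val) (hM : ∀ᶠ i in l, ∀ᵐ x ∂μ, ‖f i x‖ ≤ M)
    (hlim : ∀ᵐ x ∂μ, Tendsto (fun i => f i x) l (𝓝 (f₀ x))) : f₀ ∈ A.map (essBdd μ).val := by
  obtain ⟨u, hu⟩ := exists_seq_tendsto l
  obtain ⟨N, hN⟩ := eventually_atTop.1 (hu.eventually (hf.and hM))
  choose b hbA hbf using fun n => (hN (n + N) (Nat.le_add_left N n)).1
  have hbf' (n : ℕ) : (b n : α → ℂ) = f (u (n + N)) := hbf n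
  have hlim' : ∀ᵐ x ∂μ, Tendsto (fun n => (b n : α → ℂ) x) atTop (𝓝 (f₀ x)) := by
    filter_upwards [hlim] with x hx
    simp only [hbf']
    exact hx.comp (hu.comp (tendsto_add_atTop_nat N))
  have hM' (n : ℕ) : ∀ᵐ x ∂μ, ‖(b n : α → ℂ) x‖ ≤ M := by
    rw [hbf']
    exact (hN (n + N) (Nat.le_add_left N n)).2
  have hf₀ : f₀ ∈ essBdd μ := by
    refine mem_essBdd_of_bound (M := M)
      (aestronglyMeasurable_of_tendsto_ae atTop (fun n => (b n).2.1) hlim') ?_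
    filter_upwards [hlim', ae_all_iff.2 hM'] with x hx hxM
    exact le_of_tendsto' hx.norm hxM
  exact ⟨⟨f₀, hf₀⟩, hA ⟨⟨M, .of_forall hM'⟩, hlim'⟩ hbA, rfl⟩

theorem IsBddClosed.comp_mem_map (hA : IsBddClosed (A : Set (essBdd μ))) {k : ℂ → ℂ}
    (hk : DifferentiableOn ℂ k (Metric.ball 0 1)) {a : α → ℂ} (ha : a ∈ A.map (essBdd μ).val)
    {r : ℝ} (hr₁ : r < 1) (hr : ∀ x, ‖a x‖ ≤ r) : k ∘ a ∈ A.map (essBdd μ).val := by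
  obtain ⟨r', hrr', hr'₁⟩ := exists_between (max_lt hr₁ one_pos)
  obtain ⟨R, hr'R, hR₁⟩ := exists_between hr'₁
  lift r' to ℝ≥0 using ((le_max_right r 0).trans_lt hrr').le
  lift R to ℝ≥0 using r'.2.trans hr'R.le
  have hR₀ : 0 < R := lt_of_le_of_lt (zero_le (a := r')) (by exact_mod_cast hr'R)
  have hseries := (hk.mono (Metric.closedBall_subset_ball hR₁)).hasFPowerSeriesOnBall hR₀
  have hunif := hseries.tendstoUniformlyOn (r' := r') (by exact_mod_cast hr'R)
  obtain ⟨M, hM⟩ := (isCompact_closedBall (0 : ℂ) r').exists_bound_of_continuousOn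
    (hk.continuousOn.mono (Metric.closedBall_subset_ball hr'₁))
  have hmem (x : α) : a x ∈ Metric.ball (0 : ℂ) r' :=
    mem_ball_zero_iff.2 ((hr x).trans_lt ((le_max_left r 0).trans_lt hrr'))
  set p := cauchyPowerSeries k 0 R
  have hpartial (n : ℕ) (x : α) :
      (∑ i ∈ Finset.range n, p.coeff i • a ^ i) x = p.partialSum n (a x) := by
    rw [Finset.sum_apply, FormalMultilinearSeries.partialSum]
    refine Finset.sum_congr rfl fun i _ => ?_
    rw [FormalMultilinearSeries.apply_eq_pow_smul_coeff, Pi.smul_apply, Pi.pow_apply, smul_eq_mul,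
      smul_eq_mul, mul_comm]
  refine hA.mem_map_of_tendsto (l := atTop) (f := fun n => ∑ i ∈ Finset.range n, p.coeff i • a ^ i)
    (M := 1 + M) (.of_forall fun n => sum_mem fun i _ => Subalgebra.smul_mem _ (pow_mem ha i) _)
    ?_ (.of_forall fun x => ?_)
  · filter_upwards [Metric.tendstoUniformlyOn_iff.1 hunif 1 one_pos] with n hn
    refine .of_forall fun x => ?_
    have hclose := hn _ (hmem x)
    rw [zero_add, dist_comm, dist_eq_norm] at hclose
    rw [hpartial]
    exact (norm_le_norm_sub_add _ (k (a x))).trans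
      (add_le_add hclose.le (hM _ (Metric.ball_subset_closedBall (hmem x))))
  · simpa only [hpartial, zero_add, Function.comp_apply] using hunif.tendsto_at (hmem x)

end BddClosed

namespace HInftyMinus

theorem norm_le_hInftyNorm (g : HInftyMinus) {s : ℂ} (hs : s.re < 0) :
    ‖(g : ℂ → ℂ) s‖ ≤ hInftyNorm g := by
  obtain ⟨M, hM⟩ := g.2.2
  exact le_ciSup (f := fun s : {s : ℂ // s.re < 0} => ‖(g : ℂ → ℂ) s‖)
    ⟨M, forall_mem_range.2 fun s => hM s s.2⟩ ⟨s, hs⟩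

theorem ae_tendsto_boundaryFun (g : HInftyMinus) : ∀ᵐ ξ : ℝ,
    Tendsto (fun r : ℝ => (g : ℂ → ℂ) (r + boundaryPoint ξ)) (𝓝[<] 0)
      (𝓝 (boundaryFun g (2 * Real.pi * ξ))) := by
  obtain ⟨M, hM⟩ := g.2.2
  have hscale : Measure.QuasiMeasurePreserving (fun ξ : ℝ => 2 * Real.pi * ξ) volume volume := by
    refine ⟨by fun_prop, ?_⟩
    rw [Real.map_volume_mul_left Real.two_pi_pos.ne']
    exact Measure.smul_absolutelyContinuous
  filter_upwards [hscale.ae (ae_exists_tendsto_of_re_neg g.2.1 hM)] with ξ hξ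
  simpa [boundaryPoint, boundaryFun] using tendsto_nhds_limUnder hξ

theorem ae_norm_boundaryFun_le (g : HInftyMinus) :
    ∀ᵐ ξ : ℝ, ‖boundaryFun g (2 * Real.pi * ξ)‖ ≤ hInftyNorm g := by
  filter_upwards [ae_tendsto_boundaryFun g] with ξ hξ
  refine le_of_tendsto hξ.norm ?_
  filter_upwards [self_mem_nhdsWithin] with r hr
  exact norm_le_hInftyNorm g (by simpa using hr)

theorem continuous_add_boundaryPoint (g : HInftyMinus) {r : ℝ} (hr : r < 0) :
    Continuous fun ξ => (g : ℂ → ℂ) (r + boundaryPoint ξ) :=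
  g.2.1.continuousOn.comp_continuous (by fun_prop) fun ξ => by simpa using hr

/-- The boundary function of `g`, as a symbol. -/
def boundarySymbol (g : HInftyMinus) : essBddLine :=
  ⟨fun ξ => boundaryFun g (2 * Real.pi * ξ), by
    refine mem_essBdd_of_bound ?_ (ae_norm_boundaryFun_le g)
    obtain ⟨u, -, hu, hlim⟩ := exists_seq_strictMono_tendsto' (neg_one_lt_zero (R := ℝ))
    refine aestronglyMeasurable_of_tendsto_ae atTop
      (fun n => (continuous_add_boundaryPoint g (hu n).2).aestronglyMeasurable) ?_
    filter_upwards [ae_tendsto_boundaryFun g] with ξ hξ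
    exact hξ.comp (tendsto_nhdsWithin_iff.2 ⟨hlim, .of_forall fun n => (hu n).2⟩)⟩

theorem ae_tendsto_boundarySymbol (g : HInftyMinus) : ∀ᵐ ξ : ℝ,
    Tendsto (fun r : ℝ => (g : ℂ → ℂ) (r + boundaryPoint ξ)) (𝓝[<] 0)
      (𝓝 ((boundarySymbol g : ℝ → ℂ) ξ)) :=
  ae_tendsto_boundaryFun g

theorem ae_norm_boundarySymbol_le (g : HInftyMinus) :
    ∀ᵐ ξ : ℝ, ‖(boundarySymbol g : ℝ → ℂ) ξ‖ ≤ hInftyNorm g :=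
  ae_norm_boundaryFun_le g

theorem boundarySymbol_eq_of_tendsto {g : HInftyMinus} {ξ : ℝ} {z : ℂ}
    (h : Tendsto (fun r : ℝ => (g : ℂ → ℂ) (r + boundaryPoint ξ)) (𝓝[<] 0) (𝓝 z)) :
    (boundarySymbol g : ℝ → ℂ) ξ = z := by
  refine Tendsto.limUnder_eq ?_
  simpa [boundaryPoint] using h

theorem boundarySymbol_eq_of_continuousAt {g : HInftyMinus} {k : ℂ → ℂ}
    (hgk : ∀ s : ℂ, s.re < 0 → (g : ℂ → ℂ) s = k s) {ξ : ℝ}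
    (hk : ContinuousAt k (boundaryPoint ξ)) :
    (boundarySymbol g : ℝ → ℂ) ξ = k (boundaryPoint ξ) := by
  have hshift : Tendsto (fun r : ℝ => r + boundaryPoint ξ) (𝓝[<] 0) (𝓝 (boundaryPoint ξ)) :=
    (Continuous.tendsto' (by fun_prop) 0 _ (by simp)).mono_left nhdsWithin_le_nhds
  refine boundarySymbol_eq_of_tendsto ((hk.tendsto.comp hshift).congr' ?_)
  filter_upwards [self_mem_nhdsWithin] with r hr
  exact (hgk _ (by simpa using hr)).symm

theorem ae_boundarySymbol_add (g h : HInftyMinus) : (boundarySymbol (g + h) : ℝ → ℂ) =ᵐ[volume]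
    (boundarySymbol g + boundarySymbol h : essBddLine) := by
  filter_upwards [ae_tendsto_boundarySymbol g, ae_tendsto_boundarySymbol h] with ξ hg hh
  exact boundarySymbol_eq_of_tendsto (hg.add hh)

theorem ae_boundarySymbol_mul (g h : HInftyMinus) : (boundarySymbol (g * h) : ℝ → ℂ) =ᵐ[volume]
    (boundarySymbol g * boundarySymbol h : essBddLine) := by
  filter_upwards [ae_tendsto_boundarySymbol g, ae_tendsto_boundarySymbol h] with ξ hg hh
  exact boundarySymbol_eq_of_tendsto (hg.mul hh)

theorem ae_boundarySymbol_smul (c : ℂ) (g : HInftyMinus) :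
    (boundarySymbol (c • g) : ℝ → ℂ) =ᵐ[volume] (c • boundarySymbol g : essBddLine) := by
  filter_upwards [ae_tendsto_boundarySymbol g] with ξ hg
  exact boundarySymbol_eq_of_tendsto (hg.const_smul c)

theorem boundarySymbol_one : boundarySymbol 1 = 1 :=
  Subtype.ext (funext fun _ => boundarySymbol_eq_of_tendsto tendsto_const_nhds)

/-- The function `s ↦ exp (τ s)`, whose Toeplitz operator is the left translation by `τ`. -/
def expFun (τ : ℝ≥0) : HInftyMinus :=
  ⟨fun s => Complex.exp (τ * s), by fun_prop, 1, fun s hs => by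
    rw [Complex.norm_exp, Real.exp_le_one_iff]
    simpa using mul_nonpos_of_nonneg_of_nonpos τ.2 hs.le⟩

theorem boundarySymbol_expFun (τ : ℝ≥0) : boundarySymbol (expFun τ) = expSymbol τ := by
  ext ξ
  exact boundarySymbol_eq_of_continuousAt (k := fun s => Complex.exp (τ * s)) (fun _ _ => rfl)
    (by fun_prop)

end HInftyMinus

section Approximation

variable {A : Subalgebra ℂ essBddLine}

theorem exp_mul_sub_one_mem_map {τ : ℝ} (hexp : expSymbol τ ∈ A) :
    (fun ξ => Complex.exp (τ * (boundaryPoint ξ - 1))) ∈ A.map essBddLine.val := by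
  have heq : (fun ξ => Complex.exp (τ * (boundaryPoint ξ - 1))) =
      Complex.exp (-τ) • essBddLine.val (expSymbol τ) := by
    ext ξ
    rw [Pi.smul_apply, smul_eq_mul, Subalgebra.coe_val, expSymbol_apply, ← Complex.exp_add]
    ring_nf
  rw [heq]
  exact Subalgebra.smul_mem _ (Subalgebra.mem_map.2 ⟨_, hexp, rfl⟩) _

theorem norm_exp_mul_boundaryPoint_sub_one (τ ξ : ℝ) :
    ‖Complex.exp (τ * (boundaryPoint ξ - 1))‖ = Real.exp (-τ) := by
  rw [Complex.norm_exp, Complex.re_ofReal_mul]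
  simp

theorem inv_one_sub_exp_mem_map (hA : IsBddClosed (A : Set essBddLine)) {τ : ℝ} (hτ : 0 < τ)
    (hexp : expSymbol τ ∈ A) :
    (fun ξ => (1 - Complex.exp (τ * (boundaryPoint ξ - 1)))⁻¹) ∈ A.map essBddLine.val := by
  have hk : DifferentiableOn ℂ (fun w : ℂ => (1 - w)⁻¹) (Metric.ball 0 1) := by
    refine DifferentiableOn.inv (by fun_prop) fun w hw => sub_ne_zero.2 ?_
    rintro rfl
    simp at hw
  exact hA.comp_mem_map hk (exp_mul_sub_one_mem_map hexp) (Real.exp_lt_one_iff.2 (neg_lt_zero.2 hτ))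
    fun ξ => (norm_exp_mul_boundaryPoint_sub_one τ ξ).le

theorem norm_mul_inv_one_sub_exp_le {τ : ℝ} (hτ : 0 < τ) (hτ₁ : τ ≤ 1) (ξ : ℝ) :
    ‖τ * (1 - Complex.exp (τ * (boundaryPoint ξ - 1)))⁻¹‖ ≤ 2 := by
  have hexp : Real.exp (-τ) * (1 + τ) ≤ 1 := by
    rw [Real.exp_neg, inv_mul_le_one₀ (Real.exp_pos τ), add_comm]
    exact Real.add_one_le_exp τ
  have hnorm : 1 - Real.exp (-τ) ≤ ‖1 - Complex.exp (τ * (boundaryPoint ξ - 1))‖ := by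
    rw [← norm_exp_mul_boundaryPoint_sub_one τ ξ]
    simpa using norm_sub_norm_le 1 (Complex.exp (τ * (boundaryPoint ξ - 1)))
  have hpos : 0 < 1 - Real.exp (-τ) := sub_pos.2 (Real.exp_lt_one_iff.2 (neg_lt_zero.2 hτ))
  rw [norm_mul, norm_inv, Complex.norm_of_nonneg hτ.le, ← div_eq_mul_inv,
    div_le_iff₀ (hpos.trans_le hnorm)]
  nlinarith

theorem tendsto_inv_mul_exp_sub_one (z : ℂ) :
    Tendsto (fun τ : ℝ => (τ : ℂ)⁻¹ * (Complex.exp (τ * z) - 1)) (𝓝[>] 0) (𝓝 z) := by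
  have hderiv : HasDerivAt (fun τ : ℝ => Complex.exp (τ * z)) z 0 := by
    simpa using ((Complex.ofRealCLM.hasDerivAt (x := (0 : ℝ))).mul_const z).cexp
  refine (hderiv.tendsto_slope.mono_left (nhdsGT_le_nhdsNE 0)).congr fun τ => ?_
  simp [slope]

theorem tendsto_mul_inv_one_sub_exp {z : ℂ} (hz : z ≠ 0) :
    Tendsto (fun τ : ℝ => τ * (1 - Complex.exp (τ * z))⁻¹) (𝓝[>] 0) (𝓝 (-z)⁻¹) := by
  refine ((tendsto_inv_mul_exp_sub_one z).neg.inv₀ (neg_ne_zero.2 hz)).congr fun τ => ?_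
  rw [← mul_neg, neg_sub, mul_inv, inv_inv]

theorem inv_one_sub_boundaryPoint_mem_map (hA : IsBddClosed (A : Set essBddLine))
    (hexp : ∀ τ : ℝ, 0 ≤ τ → expSymbol τ ∈ A) :
    (fun ξ => (1 - boundaryPoint ξ)⁻¹) ∈ A.map essBddLine.val := by
  refine hA.mem_map_of_tendsto (l := 𝓝[>] (0 : ℝ)) (M := 2)
    (f := fun τ ξ => τ * (1 - Complex.exp (τ * (boundaryPoint ξ - 1)))⁻¹) ?_ ?_
    (.of_forall fun ξ => ?_)
  · filter_upwards [self_mem_nhdsWithin] with τ hτ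
    exact Subalgebra.smul_mem _ (inv_one_sub_exp_mem_map hA hτ (hexp τ (le_of_lt hτ))) (τ : ℂ)
  · filter_upwards [Ioc_mem_nhdsGT one_pos] with τ hτ
    exact .of_forall (norm_mul_inv_one_sub_exp_le hτ.1 hτ.2)
  · have hne : boundaryPoint ξ - 1 ≠ 0 := by
      rw [← neg_sub]
      exact neg_ne_zero.2 (one_sub_ne_zero_of_re_nonpos (boundaryPoint_re ξ).le)
    simpa using tendsto_mul_inv_one_sub_exp hne

theorem planeToDisc_boundaryPoint_mem_map (hA : IsBddClosed (A : Set essBddLine))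
    (hexp : ∀ τ : ℝ, 0 ≤ τ → expSymbol τ ∈ A) :
    (fun ξ => planeToDisc (boundaryPoint ξ)) ∈ A.map essBddLine.val := by
  have heq : (fun ξ => planeToDisc (boundaryPoint ξ)) =
      (2 : ℂ) • (fun ξ => (1 - boundaryPoint ξ)⁻¹) - 1 := by
    ext ξ
    rw [Pi.sub_apply, Pi.smul_apply, smul_eq_mul, ← div_eq_mul_inv,
      ← planeToDisc_add_one (boundaryPoint_re ξ).le, Pi.one_apply, add_sub_cancel_right]
  rw [heq]
  exact sub_mem (Subalgebra.smul_mem _ (inv_one_sub_boundaryPoint_mem_map hA hexp) _) (one_mem _)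

theorem comp_planeToDisc_mem_map (hA : IsBddClosed (A : Set essBddLine))
    (hexp : ∀ τ : ℝ, 0 ≤ τ → expSymbol τ ∈ A) {k : ℂ → ℂ}
    (hk : DifferentiableOn ℂ k (Metric.ball 0 1)) {M : ℝ} (hM : ∀ w : ℂ, ‖w‖ < 1 → ‖k w‖ ≤ M)
    (hcont : ∀ ξ, ContinuousAt k (planeToDisc (boundaryPoint ξ))) :
    (fun ξ => k (planeToDisc (boundaryPoint ξ))) ∈ A.map essBddLine.val := by
  have hle {r : ℝ} (hr : r ∈ Ioo (0 : ℝ) 1) (ξ : ℝ) :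
      ‖(r : ℂ) * planeToDisc (boundaryPoint ξ)‖ ≤ r := by
    rw [norm_mul, Complex.norm_of_nonneg hr.1.le]
    exact mul_le_of_le_one_right hr.1.le (norm_planeToDisc_le_one (boundaryPoint_re ξ).le)
  refine hA.mem_map_of_tendsto (l := 𝓝[<] (1 : ℝ)) (M := M)
    (f := fun r ξ => k (r * planeToDisc (boundaryPoint ξ))) ?_ ?_ (.of_forall fun ξ => ?_)
  · filter_upwards [Ioo_mem_nhdsLT one_pos] with r hr
    exact hA.comp_mem_map hk (Subalgebra.smul_mem _ (planeToDisc_boundaryPoint_mem_map hA hexp)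
      (r : ℂ)) hr.2 (hle hr)
  · filter_upwards [Ioo_mem_nhdsLT one_pos] with r hr
    exact .of_forall fun ξ => hM _ ((hle hr ξ).trans_lt hr.2)
  · have hscale : Continuous fun r : ℝ => (r : ℂ) * planeToDisc (boundaryPoint ξ) := by fun_prop
    have hlim := hscale.tendsto 1
    rw [Complex.ofReal_one, one_mul] at hlim
    exact (hcont ξ).tendsto.comp (hlim.mono_left nhdsWithin_le_nhds)

theorem HInftyMinus.add_boundaryPoint_mem_map (hA : IsBddClosed (A : Set essBddLine))
    (hexp : ∀ τ : ℝ, 0 ≤ τ → expSymbol τ ∈ A) (g : HInftyMinus) {r : ℝ} (hr : r < 0) :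
    (fun ξ => (g : ℂ → ℂ) (r + boundaryPoint ξ)) ∈ A.map essBddLine.val := by
  have hre {s : ℂ} (hs : s.re ≤ 0) : (r + s).re < 0 := by simpa using by linarith
  have hd {s : ℂ} (hs : s.re ≤ 0) : DifferentiableAt ℂ (fun s => (g : ℂ → ℂ) (r + s)) s :=
    (g.2.1.differentiableAt (isOpen_setOf_re_neg.mem_nhds (hre hs))).comp s
      (differentiableAt_id.const_add (r : ℂ))
  have hk : DifferentiableOn ℂ (fun w => (g : ℂ → ℂ) (r + discToPlane w)) (Metric.ball 0 1) :=
    fun w hw => (differentiableAt_comp_discToPlane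
      (fun s (hs : s.re < 0) => (hd hs.le).differentiableWithinAt)
      (mem_ball_zero_iff.1 hw)).differentiableWithinAt
  have hmem := comp_planeToDisc_mem_map hA hexp hk
    (fun w hw => norm_le_hInftyNorm g (hre (discToPlane_re_neg hw).le)) fun ξ => ?_
  · simpa only [discToPlane_planeToDisc (boundaryPoint_re _).le] using hmem
  · have hne : planeToDisc (boundaryPoint ξ) + 1 ≠ 0 := by
      rw [planeToDisc_add_one (boundaryPoint_re ξ).le]
      exact div_ne_zero two_ne_zero (one_sub_ne_zero_of_re_nonpos (boundaryPoint_re ξ).le)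
    refine ContinuousAt.comp (g := fun s => (g : ℂ → ℂ) (r + s)) ?_
      (hasDerivAt_discToPlane hne).continuousAt
    rw [discToPlane_planeToDisc (boundaryPoint_re ξ).le]
    exact (hd (boundaryPoint_re ξ).le).continuousAt

theorem HInftyMinus.boundarySymbol_mem (hA : IsBddClosed (A : Set essBddLine))
    (hexp : ∀ τ : ℝ, 0 ≤ τ → expSymbol τ ∈ A) (g : HInftyMinus) : boundarySymbol g ∈ A := by
  suffices h : (boundarySymbol g : ℝ → ℂ) ∈ A.map essBddLine.val by
    obtain ⟨b, hb, hbg⟩ := h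
    rwa [← Subtype.ext hbg]
  refine hA.mem_map_of_tendsto (l := 𝓝[<] (0 : ℝ)) (M := hInftyNorm g) ?_ ?_
    (ae_tendsto_boundarySymbol g)
  · filter_upwards [self_mem_nhdsWithin] with r hr
    exact add_boundaryPoint_mem_map hA hexp g hr
  · filter_upwards [self_mem_nhdsWithin] with r hr
    exact .of_forall fun ξ => norm_le_hInftyNorm g (by simpa using hr)

end Approximation

theorem tendsto_coe_nhdsGT_zero :
    Tendsto (fun h : ℝ≥0 => (h : ℝ)) (𝓝[>] 0) (𝓝[>] 0) :=
  tendsto_nhdsWithin_iff.2 ⟨(NNReal.continuous_coe.tendsto' 0 0 rfl).mono_left nhdsWithin_le_nhds,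
    by filter_upwards [self_mem_nhdsWithin] with h hh using NNReal.coe_pos.2 hh⟩

namespace HInftyMinus

section ResolventSymbol

/-- The function `s ↦ (exp (h s) - 1) / h`, corresponding to the difference quotient
`(T(h) - 1) / h`; it vanishes identically for `h = 0`. -/
def expDiffQuot (h : ℝ≥0) : HInftyMinus := ((h : ℝ) : ℂ)⁻¹ • (expFun h - 1)

theorem norm_inv_mul_exp_sub_one_le (h : ℝ≥0) (ξ : ℝ) :
    ‖((h : ℝ) : ℂ)⁻¹ * (Complex.exp ((h : ℝ) * boundaryPoint ξ) - 1)‖ ≤ ‖boundaryPoint ξ‖ := by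
  rcases eq_zero_or_pos h with rfl | hpos
  · simp
  have hexp : (h : ℝ) * boundaryPoint ξ = Complex.I * ((h * (2 * Real.pi * ξ) : ℝ) : ℂ) := by
    rw [boundaryPoint]
    push_cast
    ring
  rw [norm_mul, norm_inv, Complex.norm_of_nonneg h.coe_nonneg,
    inv_mul_le_iff₀ (NNReal.coe_pos.2 hpos), hexp]
  refine Real.norm_exp_I_mul_ofReal_sub_one_le.trans_eq ?_
  simp [boundaryPoint]

variable {a : ℂ} (ha : 0 < a.re) {g : HInftyMinus}
  (hg : ∀ s : ℂ, s.re < 0 → (g : ℂ → ℂ) s = (a - s)⁻¹)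

include ha in
theorem sub_boundaryPoint_ne_zero (ξ : ℝ) : a - boundaryPoint ξ ≠ 0 := by
  refine sub_ne_zero.2 fun h => ha.ne' ?_
  rw [h, boundaryPoint_re]

include ha hg

theorem boundarySymbol_expDiffQuot_mul (h : ℝ≥0) (ξ : ℝ) :
    (boundarySymbol (expDiffQuot h * g) : ℝ → ℂ) ξ =
      ((h : ℝ) : ℂ)⁻¹ * (Complex.exp ((h : ℝ) * boundaryPoint ξ) - 1) *
        (a - boundaryPoint ξ)⁻¹ := by
  refine boundarySymbol_eq_of_continuousAt
    (k := fun s => ((h : ℝ) : ℂ)⁻¹ * (Complex.exp ((h : ℝ) * s) - 1) * (a - s)⁻¹)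
    (fun s hs => congrArg (_ * ·) (hg s hs)) ?_
  exact ContinuousAt.mul (by fun_prop)
    (ContinuousAt.inv₀ (by fun_prop) (sub_boundaryPoint_ne_zero ha ξ))

theorem boundarySymbol_smul_sub_one (ξ : ℝ) :
    (boundarySymbol (a • g - 1) : ℝ → ℂ) ξ = boundaryPoint ξ * (a - boundaryPoint ξ)⁻¹ := by
  have hne := sub_boundaryPoint_ne_zero ha
  refine (boundarySymbol_eq_of_continuousAt (k := fun s => a * (a - s)⁻¹ - 1)
    (fun s hs => congrArg (a * · - 1) (hg s hs)) ?_).trans ?_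
  · exact ((ContinuousAt.inv₀ (by fun_prop) (hne ξ)).const_mul a).sub continuousAt_const
  · rw [← mul_inv_cancel₀ (hne ξ)]
    ring

theorem bddTendsto_expDiffQuot_mul :
    BddTendsto (𝓝[>] 0) (fun h => boundarySymbol (expDiffQuot h * g))
      (boundarySymbol (a • g - 1)) := by
  refine ⟨⟨hInftyNorm (a • g - 1), .of_forall fun h => ?_⟩, .of_forall fun ξ => ?_⟩
  · filter_upwards [ae_norm_boundarySymbol_le (a • g - 1)] with ξ hξ
    rw [boundarySymbol_smul_sub_one ha hg, norm_mul] at hξ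
    rw [boundarySymbol_expDiffQuot_mul ha hg, norm_mul]
    exact (mul_le_mul_of_nonneg_right (norm_inv_mul_exp_sub_one_le h ξ) (norm_nonneg _)).trans hξ
  · simp only [boundarySymbol_expDiffQuot_mul ha hg, boundarySymbol_smul_sub_one ha hg]
    exact ((tendsto_inv_mul_exp_sub_one _).comp tendsto_coe_nhdsGT_zero).mul_const _

end ResolventSymbol

end HInftyMinus

/-! ### Toeplitz operators and invariant subspaces -/

section InvariantSubspace

variable {E F : Type*} [NormedAddCommGroup E] [NormedSpace ℂ E] [NormedAddCommGroup F]
  [NormedSpace ℂ F] {R : Type*} [Ring R] [Algebra ℂ R]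

variable (E F) in
/-- The diagonal action of pairs of bounded operators on a product space. -/
def prodMapAlgHom : ((E →L[ℂ] E) × (F →L[ℂ] F)) →ₐ[ℂ] (E × F →L[ℂ] E × F) :=
  AlgHom.ofLinearMap (ContinuousLinearMap.prodMapL ℂ E E F F).toLinearMap rfl fun _ _ => rfl

/-- For a linear map `Θ` into the operators on `E` that is multiplicative on the left on a
subalgebra `A`, the elements of `A` whose image leaves the subspace `V` invariant. -/
def invariantElements (A : Subalgebra ℂ R) (Θ : R →ₗ[ℂ] (E →L[ℂ] E)) (h_one : Θ 1 = 1)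
    (h_mul : ∀ a ∈ A, ∀ b, Θ (a * b) = Θ a * Θ b) (V : Submodule ℂ E) : Subalgebra ℂ R where
  carrier := {a | a ∈ A ∧ ∀ v ∈ V, Θ a v ∈ V}
  mul_mem' := by
    rintro a b ⟨ha, haV⟩ ⟨hb, hbV⟩
    refine ⟨mul_mem ha hb, fun v hv => ?_⟩
    rw [h_mul a ha]
    exact haV _ (hbV v hv)
  add_mem' := by
    rintro a b ⟨ha, haV⟩ ⟨hb, hbV⟩
    refine ⟨add_mem ha hb, fun v hv => ?_⟩
    rw [map_add]
    exact V.add_mem (haV v hv) (hbV v hv)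
  algebraMap_mem' := fun c => by
    refine ⟨A.algebraMap_mem c, fun v hv => ?_⟩
    rw [Algebra.algebraMap_eq_smul_one, map_smul, h_one]
    exact V.smul_mem c hv

end InvariantSubspace

section ToeplitzCalculus

open HInftyMinus

variable (E F : Type*) [NormedAddCommGroup E] [InnerProductSpace ℂ E] [CompleteSpace E]
  [NormedAddCommGroup F] [InnerProductSpace ℂ F] [CompleteSpace F]

theorem toeplitzOp_eq_of_ae_eq {a b : essBddLine} (h : (a : ℝ → ℂ) =ᵐ[volume] b) :
    toeplitzOp E a = toeplitzOp E b := by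
  ext1 f
  rw [toeplitzOp_apply, toeplitzOp_apply, mulOp_eq_of_ae_eq h]

theorem boundarySymbol_mem_coanalyticSymbols (g : HInftyMinus) :
    boundarySymbol g ∈ coanalyticSymbols E :=
  boundarySymbol_mem (isBddClosed_coanalyticSymbols E)
    (fun _ hτ => expSymbol_mem_coanalyticSymbols hτ) g

/-- The homomorphism `g ↦ M_g` from `H∞⁻` into the bounded operators on `L²((0, ∞); E)`. -/
def toeplitzHom : HInftyMinus →ₐ[ℂ] (L2Half E →L[ℂ] L2Half E) :=
  AlgHom.ofLinearMap
    { toFun := fun g => toeplitzOp E (boundarySymbol g)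
      map_add' := fun g h =>
        (toeplitzOp_eq_of_ae_eq E (ae_boundarySymbol_add g h)).trans (map_add _ _ _)
      map_smul' := fun c g =>
        (toeplitzOp_eq_of_ae_eq E (ae_boundarySymbol_smul c g)).trans (map_smul _ c _) }
    ((congrArg (toeplitzOp E) boundarySymbol_one).trans toeplitzOp_one)
    fun g h => (toeplitzOp_eq_of_ae_eq E (ae_boundarySymbol_mul g h)).trans
      (toeplitzOp_mul (boundarySymbol_mem_coanalyticSymbols E g) _)

variable {E F}

theorem toeplitzHom_apply (g : HInftyMinus) (f : L2Half E) : toeplitzHom E g f = toeplitz g f := by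
  have h : mulBoundary g (laplace E f) = mulOp 2 E (boundarySymbol g) (laplace E f) :=
    toL2_eq_of_ae_eq (coeFn_mulOp _ _)
  rw [toeplitz, h, laplaceEquiv_symm_orthogonalProjectionOnto]
  rfl

theorem norm_toeplitzHom_apply_le (g : HInftyMinus) (f : L2Half E) :
    ‖toeplitzHom E g f‖ ≤ hInftyNorm g * ‖f‖ :=
  norm_toeplitzOp_apply_le _ f (ae_norm_boundarySymbol_le g)

theorem coeFn_toeplitzHom_expFun (τ : ℝ≥0) (f : L2Half E) :
    toeplitzHom E (expFun τ) f =ᵐ[halfLine] fun t => f (t + τ) := by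
  have h : toeplitzHom E (expFun τ) = toeplitzOp E (expSymbol τ) :=
    congrArg (toeplitzOp E) (boundarySymbol_expFun τ)
  rw [h]
  exact coeFn_toeplitzOp_expSymbol τ.2 f

/-- Strong continuity of a functional calculus with respect to bounded almost everywhere convergence
of boundary functions, along countably generated filters. -/
def IsBddContinuous {H : Type*} [NormedAddCommGroup H] [NormedSpace ℂ H]
    (Φ : HInftyMinus →ₐ[ℂ] (H →L[ℂ] H)) : Prop :=
  ∀ ⦃ι : Type⦄ ⦃l : Filter ι⦄ [l.IsCountablyGenerated] ⦃g : ι → HInftyMinus⦄ ⦃g₀ : HInftyMinus⦄,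
    BddTendsto l (fun i => boundarySymbol (g i)) (boundarySymbol g₀) →
      ∀ x, Tendsto (fun i => Φ (g i) x) l (𝓝 (Φ g₀ x))

variable (E F) in
/-- The diagonal action of symbols by Toeplitz operators on `L²((0, ∞); E) × L²((0, ∞); F)`. -/
def toeplitzOpProd : essBddLine →ₗ[ℂ] ((L2Half E × L2Half F) →L[ℂ] (L2Half E × L2Half F)) :=
  (prodMapAlgHom (L2Half E) (L2Half F)).toLinearMap ∘ₗ (toeplitzOp E).prod (toeplitzOp F)

variable (E F) in
/-- The diagonal action of `H∞⁻` by Toeplitz operators on `L²((0, ∞); E) × L²((0, ∞); F)`. -/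
def toeplitzProd : HInftyMinus →ₐ[ℂ] ((L2Half E × L2Half F) →L[ℂ] (L2Half E × L2Half F)) :=
  (prodMapAlgHom (L2Half E) (L2Half F)).comp ((toeplitzHom E).prod (toeplitzHom F))

theorem toeplitzOpProd_boundarySymbol (g : HInftyMinus) :
    toeplitzOpProd E F (boundarySymbol g) = toeplitzProd E F g := rfl

theorem toeplitzOpProd_apply (b : essBddLine) :
    toeplitzOpProd E F b = prodMapAlgHom _ _ (toeplitzOp E b, toeplitzOp F b) := rfl

theorem toeplitzOpProd_one : toeplitzOpProd E F 1 = 1 := by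
  rw [toeplitzOpProd_apply, toeplitzOp_one, toeplitzOp_one]
  exact map_one (prodMapAlgHom (L2Half E) (L2Half F))

theorem toeplitzOpProd_mul {a : essBddLine} (ha : a ∈ coanalyticSymbols E ⊓ coanalyticSymbols F)
    (b : essBddLine) :
    toeplitzOpProd E F (a * b) = toeplitzOpProd E F a * toeplitzOpProd E F b := by
  rw [toeplitzOpProd_apply, toeplitzOp_mul ha.1, toeplitzOp_mul ha.2]
  exact map_mul (prodMapAlgHom _ _) (toeplitzOp E a, toeplitzOp F a)
    (toeplitzOp E b, toeplitzOp F b)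

theorem BddTendsto.toeplitzOpProd {ι : Type*} {l : Filter ι} [l.IsCountablyGenerated]
    {b : ι → essBddLine} {b₀ : essBddLine} (h : BddTendsto l b b₀) (v : L2Half E × L2Half F) :
    Tendsto (fun i => toeplitzOpProd E F (b i) v) l (𝓝 (toeplitzOpProd E F b₀ v)) :=
  (h.toeplitzOp v.1).prodMk_nhds (h.toeplitzOp v.2)

theorem isBddContinuous_toeplitzProd : IsBddContinuous (toeplitzProd E F) :=
  fun _ _ _ _ _ h v => h.toeplitzOpProd v

theorem toeplitzProd_mem_of_expFun {V : Submodule ℂ (L2Half E × L2Half F)}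
    (hV : IsClosed (V : Set (L2Half E × L2Half F)))
    (hexp : ∀ (τ : ℝ≥0), ∀ v ∈ V, toeplitzProd E F (expFun τ) v ∈ V) (g : HInftyMinus)
    {v : L2Half E × L2Half F} (hv : v ∈ V) : toeplitzProd E F g v ∈ V := by
  let A := invariantElements (coanalyticSymbols E ⊓ coanalyticSymbols F) (toeplitzOpProd E F)
    toeplitzOpProd_one (fun a ha b => toeplitzOpProd_mul ha b) V
  suffices h : boundarySymbol g ∈ A by
    rw [← toeplitzOpProd_boundarySymbol]
    exact h.2 v hv
  refine boundarySymbol_mem (fun b b₀ h hb => ?_) (fun τ hτ => ?_) g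
  · refine ⟨((isBddClosed_coanalyticSymbols E).inter (isBddClosed_coanalyticSymbols F)) h
      fun n => (hb n).1, fun v hv => ?_⟩
    exact hV.mem_of_tendsto (h.toeplitzOpProd v) (.of_forall fun n => (hb n).2 v hv)
  · lift τ to ℝ≥0 using hτ
    rw [← boundarySymbol_expFun]
    exact ⟨⟨boundarySymbol_mem_coanalyticSymbols E _, boundarySymbol_mem_coanalyticSymbols F _⟩,
      hexp τ⟩

end ToeplitzCalculus

section Lift

variable {E H : Type*} [NormedAddCommGroup E] [NormedSpace ℂ E] [CompleteSpace E]
  [NormedAddCommGroup H] [NormedSpace ℂ H] [CompleteSpace H]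
  {𝒜 : Type*} [Semiring 𝒜] [Algebra ℂ 𝒜] {J : E →L[ℂ] H} (hJ : IsClosedEmbedding J)
  (ρ : 𝒜 →ₐ[ℂ] (H →L[ℂ] H))

/-- The inverse image under a closed embedding `J` of a bounded operator `B` mapping the range of
`J` into itself. -/
def pullback (B : H →L[ℂ] H) (hB : ∀ x, B (J x) ∈ LinearMap.range J.toLinearMap) : E →L[ℂ] E :=
  ((J.equivRange hJ.injective hJ.isClosed_range).symm : _ →L[ℂ] E) ∘L (B ∘L J).codRestrict _ hB

theorem map_pullback (B : H →L[ℂ] H) (hB : ∀ x, B (J x) ∈ LinearMap.range J.toLinearMap) (x : E) :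
    J (pullback hJ B hB x) = B (J x) :=
  congrArg Subtype.val ((J.equivRange hJ.injective hJ.isClosed_range).apply_symm_apply
    ⟨B (J x), hB x⟩)

/-- The restriction of a representation on `H` to an invariant closed subspace, given as the range
of a closed embedding `J`. -/
def pullbackHom (hρ : ∀ a x, ρ a (J x) ∈ LinearMap.range J.toLinearMap) : 𝒜 →ₐ[ℂ] (E →L[ℂ] E) :=
  AlgHom.ofLinearMap
    { toFun := fun a => pullback hJ (ρ a) (hρ a)
      map_add' := fun a b => by
        ext1 x
        apply hJ.injective
        simp [map_pullback]
      map_smul' := fun c a => by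
        ext1 x
        apply hJ.injective
        simp [map_pullback] }
    (by
        ext1 x
        apply hJ.injective
        simp [map_pullback])
    (fun a b => by
        ext1 x
        apply hJ.injective
        simp [map_pullback])

theorem map_pullbackHom (hρ : ∀ a x, ρ a (J x) ∈ LinearMap.range J.toLinearMap) (a : 𝒜) (x : E) :
    J (pullbackHom hJ ρ hρ a x) = ρ a (J x) :=
  map_pullback hJ (ρ a) (hρ a) x

end Lift

section LowerBound

variable {X H : Type*} [NormedAddCommGroup X] [NormedSpace ℂ X] [NormedAddCommGroup H]
  [NormedSpace ℂ H] {O : X →L[ℂ] H}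

theorem antilipschitzWith_of_mul_norm_sq_le {m : ℝ} (hm : 0 < m)
    (hlower : ∀ x, m * ‖x‖ ^ 2 ≤ ‖O x‖ ^ 2) : AntilipschitzWith (√m).toNNReal⁻¹ O := by
  refine AddMonoidHomClass.antilipschitz_of_bound O fun x => ?_
  have hm' : 0 < √m := Real.sqrt_pos.2 hm
  rw [NNReal.coe_inv, Real.coe_toNNReal _ hm'.le, le_inv_mul_iff₀ hm']
  refine le_of_sq_le_sq ?_ (norm_nonneg _)
  rw [mul_pow, Real.sq_sqrt hm.le]
  exact hlower x

theorem opNorm_le_of_norm_map_le {B : X →L[ℂ] X} {m₁ m₂ N : ℝ}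
    (hm₁ : 0 < m₁) (hlower : ∀ x, m₁ * ‖x‖ ^ 2 ≤ ‖O x‖ ^ 2)
    (hupper : ∀ x, ‖O x‖ ^ 2 ≤ m₂ * ‖x‖ ^ 2) (hN : 0 ≤ N) (hB : ∀ x, ‖O (B x)‖ ≤ N * ‖O x‖) :
    ‖B‖ ≤ √(m₂ / m₁) * N := by
  refine B.opNorm_le_bound (by positivity) fun x => ?_
  have hsq : ‖B x‖ ^ 2 ≤ m₂ / m₁ * (N * ‖x‖) ^ 2 := by
    rw [div_mul_eq_mul_div, le_div_iff₀' hm₁]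
    calc m₁ * ‖B x‖ ^ 2 ≤ ‖O (B x)‖ ^ 2 := hlower _
      _ ≤ (N * ‖O x‖) ^ 2 := by gcongr; exact hB x
      _ = N ^ 2 * ‖O x‖ ^ 2 := mul_pow _ _ _
      _ ≤ N ^ 2 * (m₂ * ‖x‖ ^ 2) := by gcongr; exact hupper x
      _ = m₂ * (N * ‖x‖) ^ 2 := by ring
  calc ‖B x‖ ≤ √(m₂ / m₁ * (N * ‖x‖) ^ 2) := Real.le_sqrt_of_sq_le hsq
    _ = √(m₂ / m₁) * N * ‖x‖ := by
      rw [Real.sqrt_mul' _ (sq_nonneg _), Real.sqrt_sq (by positivity), mul_assoc]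

end LowerBound

/-! ### Orbits and output maps -/

theorem memLp_exp_neg {ω : ℝ} (hω : 0 < ω) (M : ℝ) :
    MemLp (fun t : ℝ => M * Real.exp (-(ω * t))) 2 halfLine := by
  refine MemLp.const_mul ((memLp_two_iff_integrable_sq (by fun_prop)).2 ?_) M
  refine (integrableOn_exp_mul_Ioi (a := -(2 * ω)) (by linarith) 0).congr (.of_forall fun t => ?_)
  simp only [← Real.exp_nat_mul]
  ring_nf

namespace C0Semigroup

section Orbits

variable {X : Type*} [NormedAddCommGroup X] [NormedSpace ℂ X] {T : C0Semigroup X}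

theorem toFun_zero_apply (x : X) : T.toFun 0 x = x := by
  rw [T.map_zero, ContinuousLinearMap.id_apply]

theorem toFun_add_apply (s t : ℝ≥0) (x : X) : T.toFun (s + t) x = T.toFun s (T.toFun t x) := by
  rw [T.map_add, ContinuousLinearMap.comp_apply]

theorem toFun_comm_apply (s t : ℝ≥0) (x : X) :
    T.toFun s (T.toFun t x) = T.toFun t (T.toFun s x) := by
  rw [← toFun_add_apply, add_comm, toFun_add_apply]

theorem toFun_toNNReal_add_apply {t : ℝ} (ht : 0 ≤ t) (τ : ℝ≥0) (x : X) :
    T.toFun (t + τ).toNNReal x = T.toFun t.toNNReal (T.toFun τ x) := by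
  rw [Real.toNNReal_add ht τ.coe_nonneg, toFun_add_apply, Real.toNNReal_coe]

theorem tendsto_toFun_nhds_zero (x : X) : Tendsto (fun t : ℝ≥0 => T.toFun t x) (𝓝 0) (𝓝 x) := by
  have h : ContinuousWithinAt (fun t : ℝ≥0 => T.toFun t x) (Ioi 0) 0 := by
    rw [ContinuousWithinAt, toFun_zero_apply]
    exact T.tendsto_zero x
  have huniv : Ici (0 : ℝ≥0) = univ := eq_univ_of_forall fun _ => mem_Ici.2 zero_le
  rw [continuousWithinAt_Ioi_iff_Ici, huniv, continuousWithinAt_univ] at h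
  simpa only [ContinuousAt, toFun_zero_apply] using h

theorem norm_toFun_sub_toFun_le {M : ℝ} (hM : ∀ t, ‖T.toFun t‖ ≤ M) (s t : ℝ≥0) (x : X) :
    ‖T.toFun t x - T.toFun s x‖ ≤ M * ‖T.toFun (nndist t s) x - x‖ := by
  wlog hst : s ≤ t generalizing s t
  · rw [norm_sub_rev, nndist_comm]
    exact this t s (le_of_not_ge hst)
  have h : t = s + nndist t s := NNReal.eq (by simp [NNReal.dist_eq, abs_of_nonneg, hst])
  calc ‖T.toFun t x - T.toFun s x‖ = ‖T.toFun s (T.toFun (nndist t s) x - x)‖ := by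
        rw [map_sub, ← toFun_add_apply, ← h]
    _ ≤ M * ‖T.toFun (nndist t s) x - x‖ := (T.toFun s).le_of_opNorm_le (hM s) _

theorem ExponentiallyStable.exists_norm_toFun_le (hT : T.ExponentiallyStable) :
    ∃ M ω : ℝ, 0 ≤ M ∧ 0 < ω ∧ ∀ t, ‖T.toFun t‖ ≤ M * Real.exp (-(ω * t)) := by
  obtain ⟨M, ω, hω, h⟩ := hT
  exact ⟨M, ω, by simpa using (norm_nonneg _).trans (h 0), hω, h⟩

theorem ExponentiallyStable.continuous_toFun (hT : T.ExponentiallyStable) (x : X) :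
    Continuous fun t : ℝ≥0 => T.toFun t x := by
  obtain ⟨M, ω, hM, hω, h⟩ := hT.exists_norm_toFun_le
  have hbound : ∀ t, ‖T.toFun t‖ ≤ M := fun t =>
    (h t).trans (mul_le_of_le_one_right hM (Real.exp_le_one_iff.2 (neg_nonpos.2 (by positivity))))
  refine continuous_iff_continuousAt.2 fun s => tendsto_iff_norm_sub_tendsto_zero.2 ?_
  refine squeeze_zero (fun _ => norm_nonneg _) (fun t => norm_toFun_sub_toFun_le hbound s t x) ?_
  have hdist : Tendsto (fun t : ℝ≥0 => nndist t s) (𝓝 s) (𝓝 0) :=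
    Continuous.tendsto' (by fun_prop) _ _ (nndist_self s)
  simpa using (((tendsto_toFun_nhds_zero (T := T) x).comp hdist).sub_const x).norm.const_mul M

section Domain

variable [CompleteSpace X]

theorem toFun_intervalIntegral {x : X} (hx : Continuous fun t : ℝ≥0 => T.toFun t x) {ε : ℝ}
    (hε : 0 ≤ ε) (h : ℝ≥0) :
    T.toFun h (∫ t in (0 : ℝ)..ε, T.toFun t.toNNReal x) =
      (∫ t in (0 : ℝ)..ε + h, T.toFun t.toNNReal x) - ∫ t in (0 : ℝ)..h, T.toFun t.toNNReal x := by
  have hintegrable : ∀ a b, IntervalIntegrable (fun t : ℝ => T.toFun t.toNNReal x) volume a b :=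
    (hx.comp continuous_real_toNNReal).intervalIntegrable
  have hshift : ∀ t ∈ uIcc (0 : ℝ) ε,
      T.toFun h (T.toFun t.toNNReal x) = T.toFun (t + h).toNNReal x := fun t ht => by
    rw [uIcc_of_le hε] at ht
    rw [toFun_toNNReal_add_apply ht.1, toFun_comm_apply]
  rw [← ContinuousLinearMap.intervalIntegral_comp_comm _ (hintegrable 0 ε),
    intervalIntegral.integral_interval_sub_left (hintegrable _ _) (hintegrable _ _),
    intervalIntegral.integral_congr hshift,
    intervalIntegral.integral_comp_add_right (fun t : ℝ => T.toFun t.toNNReal x), zero_add]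

theorem hasGen_intervalIntegral {x : X} (hx : Continuous fun t : ℝ≥0 => T.toFun t x) {ε : ℝ}
    (hε : 0 ≤ ε) :
    T.HasGen (∫ t in (0 : ℝ)..ε, T.toFun t.toNNReal x) (T.toFun ε.toNNReal x - x) := by
  set u : ℝ → X := fun t => T.toFun t.toNNReal x with hu
  have hderiv : ∀ a, HasDerivAt (fun b => ∫ t in (0 : ℝ)..b, u t) (u a) a :=
    fun a => ((hx.comp continuous_real_toNNReal).integral_hasStrictDerivAt 0 a).hasDerivAt
  have hderiv_sub : HasDerivAt
      (fun h : ℝ => (∫ t in (0 : ℝ)..ε + h, u t) - ∫ t in (0 : ℝ)..h, u t) (u ε - u 0) 0 :=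
    (HasDerivAt.comp_const_add ε 0 (by simpa only [add_zero] using hderiv ε)).sub (hderiv 0)
  have hslope :=
    (hderiv_sub.tendsto_slope.mono_left (nhdsGT_le_nhdsNE 0)).comp tendsto_coe_nhdsGT_zero
  have hu₀ : u 0 = x := by simp only [hu, Real.toNNReal_zero, toFun_zero_apply]
  rw [hu₀] at hslope
  refine hslope.congr fun h => ?_
  rw [Function.comp_apply, slope, diffQuot, toFun_intervalIntegral hx hε, sub_zero, vsub_eq_sub,
    add_zero, intervalIntegral.integral_same, sub_zero, ← Complex.ofReal_inv, Complex.coe_smul]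

theorem ExponentiallyStable.dense_domain (hT : T.ExponentiallyStable) :
    Dense (T.generator.domain : Set X) := by
  intro x
  have hderiv : HasDerivAt (fun b => ∫ t in (0 : ℝ)..b, T.toFun t.toNNReal x) x 0 := by
    simpa [toFun_zero_apply] using (((hT.continuous_toFun x).comp
      continuous_real_toNNReal).integral_hasStrictDerivAt 0 0).hasDerivAt
  refine mem_closure_of_tendsto (hderiv.tendsto_slope.mono_left (nhdsGT_le_nhdsNE 0)) ?_
  filter_upwards [self_mem_nhdsWithin] with ε hε
  rw [slope, sub_zero, vsub_eq_sub, intervalIntegral.integral_same, sub_zero, ← Complex.coe_smul]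
  exact T.generator.domain.smul_mem _
    ⟨_, hasGen_intervalIntegral (hT.continuous_toFun x) (le_of_lt hε)⟩

end Domain

theorem ExponentiallyStable.exists_memLp_bound (hT : T.ExponentiallyStable) :
    ∃ e : ℝ → ℝ, MemLp e 2 halfLine ∧
      ∀ x, ∀ᵐ t ∂halfLine, ‖T.toFun t.toNNReal x‖ ≤ ‖x‖ * ‖e t‖ := by
  obtain ⟨M, ω, hM, hω, h⟩ := hT.exists_norm_toFun_le
  refine ⟨_, memLp_exp_neg hω M, fun x => ?_⟩
  filter_upwards [ae_restrict_mem measurableSet_Ioi] with t ht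
  rw [Real.norm_of_nonneg (by positivity), mul_comm]
  refine (T.toFun t.toNNReal).le_of_opNorm_le ?_ x
  simpa [Real.coe_toNNReal t (le_of_lt ht)] using h t.toNNReal

end Orbits

section OrbitMap

variable {X : Type*} [NormedAddCommGroup X] [InnerProductSpace ℂ X] {T : C0Semigroup X}

theorem ExponentiallyStable.coeFn_orbit (hT : T.ExponentiallyStable) (x : X) :
    T.orbit x =ᵐ[halfLine] fun t : ℝ => T.toFun t.toNNReal x := by
  obtain ⟨e, he, hbound⟩ := hT.exists_memLp_bound
  exact coeFn_toL2 (he.of_le_mul ((hT.continuous_toFun x).comp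
    continuous_real_toNNReal).aestronglyMeasurable (hbound x))

/-- The bounded operator `x ↦ T(·) x` from `X` to `L²((0, ∞); X)`. -/
def ExponentiallyStable.orbitMap (hT : T.ExponentiallyStable) : X →L[ℂ] L2Half X :=
  LinearMap.mkContinuousOfExistsBound
    { toFun := T.orbit
      map_add' x y := by
        refine Lp.ext ?_
        filter_upwards [hT.coeFn_orbit (x + y), hT.coeFn_orbit x, hT.coeFn_orbit y,
          Lp.coeFn_add (T.orbit x) (T.orbit y)] with t hxy hx hy hadd
        rw [hxy, hadd, Pi.add_apply, hx, hy, _root_.map_add]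
      map_smul' c x := by
        refine Lp.ext ?_
        filter_upwards [hT.coeFn_orbit (c • x), hT.coeFn_orbit x,
          Lp.coeFn_smul c (T.orbit x)] with t hcx hx hsmul
        rw [RingHom.id_apply, hcx, hsmul, Pi.smul_apply, hx, map_smul] }
    (by
      obtain ⟨e, he, hbound⟩ := hT.exists_memLp_bound
      refine ⟨‖he.toLp e‖, fun x => ?_⟩
      rw [mul_comm]
      refine Lp.norm_le_mul_norm_of_ae_le_mul ?_
      filter_upwards [hT.coeFn_orbit x, he.coeFn_toLp, hbound x] with t hx he_t hle
      rw [he_t]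
      exact (congrArg norm hx).trans_le hle)

theorem ExponentiallyStable.coeFn_orbitMap (hT : T.ExponentiallyStable) (x : X) :
    hT.orbitMap x =ᵐ[halfLine] fun t : ℝ => T.toFun t.toNNReal x :=
  hT.coeFn_orbit x

open HInftyMinus in
theorem ExponentiallyStable.orbitMap_toFun [CompleteSpace X] (hT : T.ExponentiallyStable)
    (τ : ℝ≥0) (x : X) :
    hT.orbitMap (T.toFun τ x) = toeplitzHom X (expFun τ) (hT.orbitMap x) := by
  refine Lp.ext ?_
  filter_upwards [hT.coeFn_orbitMap (T.toFun τ x), coeFn_toeplitzHom_expFun τ (hT.orbitMap x),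
    ae_halfLine_comp_add_right τ.2 (hT.coeFn_orbitMap x), ae_restrict_mem measurableSet_Ioi]
    with t horbit hshift horbit_shift ht
  exact horbit.trans ((toFun_toNNReal_add_apply (le_of_lt ht) τ x).symm.trans
    (hshift.trans horbit_shift).symm)

end OrbitMap

section OutputMap

variable {X Y : Type*} [NormedAddCommGroup X] [NormedSpace ℂ X] [CompleteSpace X]
  [NormedAddCommGroup Y] {T : C0Semigroup X}

theorem IsOutputMap.norm_sq_le [NormedSpace ℂ Y] {C : T.generator.domain →ₗ[ℂ] Y}
    {O : X →L[ℂ] L2Half Y} (hO : T.IsOutputMap C O) (hT : T.ExponentiallyStable) {m : ℝ}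
    (hadm : T.AdmissibleWith C m) (x : X) : ‖O x‖ ^ 2 ≤ m * ‖x‖ ^ 2 := by
  have hclosed : IsClosed {x | ‖O x‖ ^ 2 ≤ m * ‖x‖ ^ 2} :=
    isClosed_le (by fun_prop) (by fun_prop)
  refine closure_minimal (fun x₀ hx₀ => ?_) hclosed (hT.dense_domain x)
  refine le_trans (le_of_eq ?_) (hadm ⟨x₀, hx₀⟩).2
  rw [lp_norm_sq_eq_integral]
  refine integral_congr_ae ?_
  filter_upwards [hO ⟨x₀, hx₀⟩] with t ht
  rw [ht]

open HInftyMinus in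
theorem IsOutputMap.map_toFun [InnerProductSpace ℂ Y] [CompleteSpace Y]
    {C : T.generator.domain →ₗ[ℂ] Y} {O : X →L[ℂ] L2Half Y} (hO : T.IsOutputMap C O)
    (hT : T.ExponentiallyStable) (τ : ℝ≥0) (x : X) :
    O (T.toFun τ x) = toeplitzHom Y (expFun τ) (O x) := by
  have hclosed : IsClosed {x | O (T.toFun τ x) = toeplitzHom Y (expFun τ) (O x)} :=
    isClosed_eq (O.continuous.comp (T.toFun τ).continuous)
      ((toeplitzHom Y (expFun τ)).continuous.comp O.continuous)
  refine closure_minimal (fun x₀ hx₀ => Lp.ext ?_) hclosed (hT.dense_domain x)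
  filter_upwards [hO (T.onDomain τ ⟨x₀, hx₀⟩), coeFn_toeplitzHom_expFun τ (O x₀),
    ae_halfLine_comp_add_right τ.2 (hO ⟨x₀, hx₀⟩), ae_restrict_mem measurableSet_Ioi]
    with t hout hshift hout_shift ht
  refine hout.trans (Eq.trans ?_ (hshift.trans hout_shift).symm)
  exact congrArg C (Subtype.ext (toFun_toNNReal_add_apply (le_of_lt ht) τ x₀).symm)

end OutputMap

end C0Semigroup

/-! ### The functional calculus -/

namespace C0Semigroup

section Represents

theorem hasGen_generator {X : Type*} [NormedAddCommGroup X] [NormedSpace ℂ X] {T : C0Semigroup X}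
    (x : T.generator.domain) : T.HasGen (x : X) (T.generator x) :=
  Classical.choose_spec x.2

theorem HasGen.map {X : Type*} [NormedAddCommGroup X] [NormedSpace ℂ X] {T : C0Semigroup X}
    {B : X →L[ℂ] X} (hB : ∀ τ x, B (T.toFun τ x) = T.toFun τ (B x)) {x y : X}
    (h : T.HasGen x y) : T.HasGen (B x) (B y) := by
  refine ((B.continuous.tendsto y).comp h).congr fun t => ?_
  simp only [Function.comp_apply, diffQuot, map_smul, map_sub, hB]

theorem generator_onDomain {X : Type*} [NormedAddCommGroup X] [NormedSpace ℂ X]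
    {T : C0Semigroup X} (t : ℝ≥0) (x : T.generator.domain) :
    T.generator (T.onDomain t x) = T.toFun t (T.generator x) :=
  (hasGen_generator (T.onDomain t x)).unique
    ((hasGen_generator x).map fun _ _ => toFun_comm_apply _ _ _)

theorem tendsto_onDomain_of_norm_le {X E : Type*} [NormedAddCommGroup X] [NormedSpace ℂ X]
    [NormedAddCommGroup E] [NormedSpace ℂ E] {T : C0Semigroup X}
    {G : T.generator.domain →ₗ[ℂ] E} {c : ℝ}
    (hG : ∀ x : T.generator.domain, ‖G x‖ ≤ c * (‖(x : X)‖ + ‖T.generator x‖))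
    (x : T.generator.domain) : Tendsto (fun t => G (T.onDomain t x)) (𝓝 0) (𝓝 (G x)) := by
  have hnorm (y : X) : Tendsto (fun t : ℝ≥0 => ‖T.toFun t y - y‖) (𝓝 0) (𝓝 0) :=
    tendsto_iff_norm_sub_tendsto_zero.1 (tendsto_toFun_nhds_zero y)
  have hgraph := ((hnorm x).add (hnorm (T.generator x))).const_mul c
  rw [add_zero, mul_zero] at hgraph
  refine tendsto_iff_norm_sub_tendsto_zero.2 (squeeze_zero (fun _ => norm_nonneg _) (fun t => ?_)
    hgraph)
  rw [← map_sub, ← generator_onDomain, ← LinearPMap.map_sub]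
  exact hG (T.onDomain t x - x)

variable {X : Type*} [NormedAddCommGroup X] [InnerProductSpace ℂ X] [CompleteSpace X]
  {T : C0Semigroup X} {g : HInftyMinus} {G : T.generator.domain →ₗ[ℂ] X}

theorem Represents.unique {G' : T.generator.domain →ₗ[ℂ] X} (hG : T.Represents g G)
    (hG' : T.Represents g G') : G = G' := by
  obtain ⟨⟨c, hc⟩, hout⟩ := hG
  obtain ⟨⟨c', hc'⟩, hout'⟩ := hG'
  ext x
  have hae : T.output G x =ᵐ[halfLine] T.output G' x := (hout x).symm.trans (hout' x)
  have hzero : Tendsto Real.toNNReal (𝓝[>] 0) (𝓝 0) :=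
    (continuous_real_toNNReal.tendsto' 0 0 Real.toNNReal_zero).mono_left nhdsWithin_le_nhds
  exact tendsto_nhds_unique_of_frequently_eq ((tendsto_onDomain_of_norm_le hc x).comp hzero)
    ((tendsto_onDomain_of_norm_le hc' x).comp hzero) (frequently_nhdsGT_of_ae_halfLine hae)

theorem Represents.represents_functionOfGenerator (hG : T.Represents g G) :
    T.Represents g (T.functionOfGenerator g) := by
  have h : ∃ G, T.Represents g G := ⟨G, hG⟩
  rw [functionOfGenerator, dif_pos h]
  exact h.choose_spec

theorem represents_of_intertwining (hT : T.ExponentiallyStable) {B : X →L[ℂ] X}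
    (hcomm : ∀ τ x, B (T.toFun τ x) = T.toFun τ (B x))
    (horbit : ∀ x, hT.orbitMap (B x) = toeplitz g (hT.orbitMap x)) :
    T.Represents g (B.toLinearMap ∘ₗ T.generator.domain.subtype) := by
  refine ⟨⟨‖B‖, fun x => (B.le_opNorm x).trans ?_⟩, fun x => ?_⟩
  · gcongr
    exact le_add_of_nonneg_right (norm_nonneg _)
  · rw [outputMapOf]
    change toeplitz g (hT.orbitMap x) =ᵐ[halfLine] _
    rw [← horbit]
    filter_upwards [hT.coeFn_orbitMap (B x)] with t ht
    exact ht.trans (hcomm t.toNNReal x).symm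

end Represents

section Calculus

open HInftyMinus

/-- A functional calculus of the generator of `T`: it is continuous with respect to bounded almost
everywhere convergence of boundary functions and sends `s ↦ exp (τ s)` to `T(τ)`. -/
structure IsHInftyCalculus {X : Type*} [NormedAddCommGroup X] [NormedSpace ℂ X]
    (T : C0Semigroup X) (Φ : HInftyMinus →ₐ[ℂ] (X →L[ℂ] X)) : Prop where
  isBddContinuous : IsBddContinuous Φ
  map_expFun : ∀ τ, Φ (expFun τ) = T.toFun τ

theorem exists_isHInftyCalculus {X Y : Type*} [NormedAddCommGroup X] [InnerProductSpace ℂ X]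
    [CompleteSpace X] [NormedAddCommGroup Y] [InnerProductSpace ℂ Y] [CompleteSpace Y]
    {T : C0Semigroup X} (hT : T.ExponentiallyStable) {O : X →L[ℂ] L2Half Y}
    (hO : ∀ τ x, O (T.toFun τ x) = toeplitzHom Y (expFun τ) (O x)) {K : ℝ≥0}
    (hK : AntilipschitzWith K O) :
    ∃ Φ : HInftyMinus →ₐ[ℂ] (X →L[ℂ] X), T.IsHInftyCalculus Φ ∧
      (∀ g x, O (Φ g x) = toeplitzHom Y g (O x)) ∧
      ∀ g x, hT.orbitMap (Φ g x) = toeplitz g (hT.orbitMap x) := by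
  let J : X →L[ℂ] L2Half Y × L2Half X := O.prod hT.orbitMap
  have hJ : IsClosedEmbedding J :=
    AntilipschitzWith.isClosedEmbedding (K := K)
      (fun x y => (hK x y).trans (by gcongr; exact le_max_left _ _)) J.uniformContinuous
  have hJ_toFun (τ : ℝ≥0) (x : X) : J (T.toFun τ x) = toeplitzProd Y X (expFun τ) (J x) :=
    Prod.ext (hO τ x) (hT.orbitMap_toFun τ x)
  have hinv (g : HInftyMinus) (x : X) :
      toeplitzProd Y X g (J x) ∈ LinearMap.range J.toLinearMap := by
    refine toeplitzProd_mem_of_expFun hJ.isClosed_range ?_ g ⟨x, rfl⟩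
    rintro τ _ ⟨z, rfl⟩
    exact ⟨T.toFun τ z, hJ_toFun τ z⟩
  have hΦ := map_pullbackHom hJ (toeplitzProd Y X) hinv
  refine ⟨pullbackHom hJ (toeplitzProd Y X) hinv, ⟨?_, fun τ => ?_⟩,
    fun g x => congrArg Prod.fst (hΦ g x), fun g x => ?_⟩
  · intro ι l _ g g₀ hg x
    refine hJ.isEmbedding.tendsto_nhds_iff.2 ?_
    simpa only [Function.comp_def, hΦ] using isBddContinuous_toeplitzProd hg (J x)
  · ext1 x
    exact hJ.injective ((hΦ _ x).trans (hJ_toFun τ x).symm)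
  · exact (congrArg Prod.snd (hΦ g x)).trans (toeplitzHom_apply g _)

namespace IsHInftyCalculus

variable {X : Type*} [NormedAddCommGroup X] [NormedSpace ℂ X] {T : C0Semigroup X}
  {Φ : HInftyMinus →ₐ[ℂ] (X →L[ℂ] X)} (hΦ : T.IsHInftyCalculus Φ)
include hΦ

theorem map_toFun (g : HInftyMinus) (τ : ℝ≥0) (x : X) :
    Φ g (T.toFun τ x) = T.toFun τ (Φ g x) := by
  rw [← hΦ.map_expFun]
  exact DFunLike.congr_fun ((Commute.all g (expFun τ)).map Φ).eq x

variable {a : ℂ} (ha : 0 < a.re) {g : HInftyMinus}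
  (hg : ∀ s : ℂ, s.re < 0 → (g : ℂ → ℂ) s = (a - s)⁻¹)
include ha hg

theorem hasGen_resolvent (x : X) : T.HasGen (Φ g x) (a • Φ g x - x) := by
  have hlim := hΦ.isBddContinuous (bddTendsto_expDiffQuot_mul ha hg) x
  simp only [expDiffQuot, map_mul, map_sub, map_smul, map_one, hΦ.map_expFun] at hlim
  exact hlim

theorem resolvent_apply (x : T.generator.domain) :
    Φ g (a • (x : X) - T.generator x) = x := by
  have hgen : Φ g (T.generator x) = a • Φ g (x : X) - x :=
    ((hasGen_generator x).map (hΦ.map_toFun g)).unique (hΦ.hasGen_resolvent ha hg (x : X))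
  rw [map_sub, map_smul, hgen, sub_sub_cancel]

theorem generator_resolvent (x : X) :
    ∃ h : Φ g x ∈ T.generator.domain, a • Φ g x - T.generator ⟨Φ g x, h⟩ = x := by
  have hgen := hΦ.hasGen_resolvent ha hg x
  refine ⟨⟨_, hgen⟩, ?_⟩
  rw [(hasGen_generator ⟨Φ g x, _, hgen⟩).unique hgen, sub_sub_cancel]

end IsHInftyCalculus

end Calculus

end C0Semigroup

end

theorem theoremT3p3 {X Y : Type*}
    [NormedAddCommGroup X] [InnerProductSpace ℂ X] [CompleteSpace X]
    [NormedAddCommGroup Y] [InnerProductSpace ℂ Y] [CompleteSpace Y]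
    (T : C0Semigroup X) (hT : T.ExponentiallyStable)
    (C : T.generator.domain →ₗ[ℂ] Y) (m₁ m₂ : ℝ) (hm₁ : 0 < m₁)
    (hadm : T.AdmissibleWith C m₂) (hobs : T.ExactlyObservableWith C m₁) :
    -- the operators `g(A)` are well defined
    (∀ g : HInftyMinus, T.Represents g (T.functionOfGenerator g) ∧
      ∀ G, T.Represents g G → G = T.functionOfGenerator g) ∧
    -- they extend to bounded operators on `X`, with the norm bound, and form a functional calculus
    ∃ Φ : HInftyMinus →ₐ[ℂ] (X →L[ℂ] X),
      (∀ (g : HInftyMinus) (x : T.generator.domain), Φ g x = T.functionOfGenerator g x) ∧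
      (∀ g : HInftyMinus, ‖Φ g‖ ≤ √(m₂ / m₁) * hInftyNorm g) ∧
      -- if `g(s) = (a - s)⁻¹`, then `Φ g` is the inverse of `a - A`
      ∀ (a : ℂ) (g : HInftyMinus), 0 < a.re →
        (∀ s : ℂ, s.re < 0 → (g : ℂ → ℂ) s = (a - s)⁻¹) →
        (∀ x : T.generator.domain, Φ g (a • (x : X) - T.generator x) = x) ∧
        ∀ x : X, ∃ h : Φ g x ∈ T.generator.domain,
          a • Φ g x - T.generator ⟨Φ g x, h⟩ = x := by
  obtain ⟨O, hC, hlow⟩ := hobs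
  have hlower (x : X) : m₁ * ‖x‖ ^ 2 ≤ ‖O x‖ ^ 2 :=
    (hlow x).trans_eq (lp_norm_sq_eq_integral _).symm
  obtain ⟨Φ, hΦ, hO, horbit⟩ := C0Semigroup.exists_isHInftyCalculus hT (hC.map_toFun hT)
    (antilipschitzWith_of_mul_norm_sq_le hm₁ hlower)
  have hrep (g : HInftyMinus) :=
    C0Semigroup.represents_of_intertwining hT (hΦ.map_toFun g) (horbit g)
  have hfun (g : HInftyMinus) := (hrep g).represents_functionOfGenerator
  refine ⟨fun g => ⟨hfun g, fun G hG => hG.unique (hfun g)⟩, Φ,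
    fun g x => LinearMap.congr_fun ((hrep g).unique (hfun g)) x, fun g => ?_,
    fun a g ha hg => ⟨hΦ.resolvent_apply ha hg, hΦ.generator_resolvent ha hg⟩⟩
  refine opNorm_le_of_norm_map_le hm₁ hlower (hC.norm_sq_le hT hadm)
    (Real.iSup_nonneg fun _ => norm_nonneg _) fun x => ?_
  rw [hO]
  exact norm_toeplitzHom_apply_le g (O x)
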